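/- Let $F$ be a tract, i.e. a commutative monoid with zero with $F^\times=F\setminus\{0\}$, together with a nullset $N_F\subseteq\mathbb N[F^\times]$ that contains $0$, does not contain $1$, is stable under multiplication by $F^\times$, and for which there is a unique $\epsilon\in F^\times$ with $1+\epsilon\in N_F$. Let $E$ be a finite set. A Grassmann--Plücker function of rank $r$ on $E$ is a function $\varphi:E^r\to F$ that is not identically zero, is alternating (interchanging two arguments multiplies the value by $\epsilon$, and $\varphi$ vanishes on tuples with a repeated entry), and satisfies the Plücker relations $\sum_{k=1}^{r+1}\epsilon^k\varphi(y_1,\dots,\widehat{y_k},\dots,y_{r+1})\varphi(y_k,x_1,\dots,x_{r-1})\in N_F$ for all $x_i,y_j\in E$. An $F$-matroid of rank $r$ on $E$ is a class $M_\varphi=[\varphi]$ of such functions up to multiplication by elements of $F^\times$; the bases of its underlying matroid $\underline M_\varphi$ are the sets $\{x_1,\dots,x_r\}$ with $\varphi(x_1,\dots,x_r)\ne 0$. For $A\subseteq E$, the contraction $M_\varphi/A$ is the $F$-matroid on $E\setminus A$ represented by $\varphi(\,\cdot\,,a_1,\dots,a_\ell)$ for a maximal independent subset $\{a_1,\dots,a_\ell\}$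 of $A$ in $\underline M_\varphi$, and the deletion $M_\varphi\setminus A$ is represented by $\varphi(\,\cdot\,,a_1,\dots,a_m)$ for a basis $\{a_1,\dots,a_m\}\subseteq A$ of the matroid $\underline M_\varphi/(E\setminus A)$. A flag $F$-matroid on $E$ is a sequence $(M_1,\dots,M_s)$ of $F$-matroids on $E$ such that for all $i<j$ and all Grassmann--Plücker functions $\mu:E^r\to F$ and $\nu:E^w\to F$ representing $M_i$ and $M_j$, one has $\sum_{k=1}^{w+1}\epsilon^k\nu(y_1,\dots,\widehat{y_k},\dots,y_{w+1})\mu(y_k,x_1,\dots,x_{r-1})\in N_F$ for all $x_1,\dots,x_{r-1},y_1,\dots,y_{w+1}\in E$ (there is no condition if $r=0$). Its rank is the sequence of the ranks of the $M_i$. (1) Let $p\ge 0$, let $M'$ be an $F$-matroid on $E'=E\sqcup\{n+1,\dots,n+p\}$, and let $0\le n_s\le\dots\le n_1\le p$ be integers. Put $J_i=\{n+1,\dots,n+n_i\}$, $I_i=\{n+n_i+1,\dots,n+p\}$ and $M_i=M'\setminus I_i/J_i$. Then $(M_1,\dots,M_s)$ is a flag $F$-matroid on $E$. (2) Fix an involution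 $x\mapsto\overline x$ of $F$, i.e. a tract endomorphism whose square is the identity. For $X,Y\in F^n$ write $X\perp Y$ if $\sum_i X_i\overline{Y_i}\in N_F$. For an $F$-matroid $M=M_\varphi$ of rank $r$ on $\{1,\dots,n\}$, the set $\mathcal C(M)\subseteq F^n$ of $F$-circuits consists of all $F^\times$-multiples of the tuples $X_C$, for $C$ a circuit of $\underline M$, $y_0\in C$ and $\{y_1,\dots,y_r\}$ a basis containing $C\setminus\{y_0\}$, with $X_C(y_i)=\epsilon^i\varphi(y_0,\dots,\widehat{y_i},\dots,y_r)$ and $X_C$ zero outside $\{y_0,\dots,y_r\}$. The set of $F$-cocircuits is $\mathcal C^*(M)=\mathcal C(M^*)$, where the dual $M^*$ is represented by $\varphi^*(x_1,\dots,x_{n-r})=\mathrm{sign}(x_1,\dots,x_{n-r},x_1',\dots,x_r')\,\overline{\varphi(x_1',\dots,x_r')}$ whenever $\{1,\dots,n\}=\{x_1,\dots,x_{n-r},x'_1,\dots,x'_r\}$ (with $-1$ read as $\epsilon$), and by zero on all other tuples. The sets of vectors and covectors are $\mathcal V(M)=\mathcal C^*(M)^\perp$ and $\mathcal V^*(M)=\mathcal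 C(M)^\perp$. The tract $F$ is perfect if $\mathcal V(M)\perp\mathcal V^*(M)$ for all $n\ge 0$ and all $F$-matroids $M$ on $\{1,\dots,n\}$. Assume that $F$ is perfect, and let $\mathbf M$ be a flag $F$-matroid of rank $(r,r+1)$ on $E$. Then there is an $F$-matroid $\widehat M$ of rank $r+1$ on $E\sqcup\{e\}$ such that $\mathbf M=(\widehat M/e,\ \widehat M\setminus e)$. Moreover, the set of all $F$-matroids $\widehat M$ on $E\sqcup\{e\}$ with $\mathbf M=(\widehat M/e,\ \widehat M\setminus e)$ is in bijection with $F^\times$. -/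

import Mathlib

universe u v w

/-- A tract: a commutative pointed monoid `F` with `Fˣ = F - {0}`, together with a nullset `N_F`
in the group semiring `ℕ[Fˣ]`. -/
class Tract (F : Type u) extends CommGroupWithZero F where
  /-- The nullset `N_F ⊆ ℕ[Fˣ]`. -/
  nullset : Set (MonoidAlgebra ℕ Fˣ)
  zero_mem_nullset : (0 : MonoidAlgebra ℕ Fˣ) ∈ nullset
  one_notMem_nullset : (1 : MonoidAlgebra ℕ Fˣ) ∉ nullset
  existsUnique_eps : ∃! e : Fˣ, (1 : MonoidAlgebra ℕ Fˣ) + MonoidAlgebra.single e 1 ∈ nullset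
  single_mul_mem_nullset : ∀ (a : Fˣ), ∀ x ∈ nullset, MonoidAlgebra.single a 1 * x ∈ nullset

namespace Tract

variable {F : Type u} [Tract F]

/-- The unique unit `ε` with `1 + ε ∈ N_F`. -/
noncomputable def epsUnit (F : Type u) [Tract F] : Fˣ :=
  (existsUnique_eps (F := F)).choose

/-- The element `ε` of `F`. -/
noncomputable def eps (F : Type u) [Tract F] : F := (epsUnit F : F)

open Classical in
/-- An element of `F` as an element of the group semiring `ℕ[Fˣ]`; the zero of `F` is sent
to the zero of `ℕ[Fˣ]`. -/
noncomputable def term (a : F) : MonoidAlgebra ℕ Fˣ :=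
  if h : a = 0 then 0 else MonoidAlgebra.single (Units.mk0 a h) 1

/-- `SumNull a` says that the formal sum `∑ i, a i` belongs to the nullset. -/
def SumNull {ι : Type w} [Fintype ι] (a : ι → F) : Prop :=
  ∑ i, term (a i) ∈ (nullset : Set (MonoidAlgebra ℕ Fˣ))

/-- An involution of `F`: a tract endomorphism whose square is the identity. -/
structure Involution (F : Type u) [Tract F] where
  toFun : F → F
  map_zero : toFun 0 = 0
  map_one : toFun 1 = 1
  map_mul : ∀ a b, toFun (a * b) = toFun a * toFun b
  map_null : ∀ (m : ℕ) (a : Fin m → F), SumNull a → SumNull (fun i => toFun (a i))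
  invol : ∀ a, toFun (toFun a) = a

@[simp] theorem term_zero : term (0 : F) = 0 := by simp [term]

end Tract

open Tract in
/-- The Plücker flag relations between `ν : E^w → F` and `μ : E^r → F`:
`∑_{k=1}^{w+1} ε^k ν(y_1,…,ŷ_k,…,y_{w+1}) μ(y_k,x_1,…,x_{r-1}) ∈ N_F`. The indices in Lean
start at `0`. If `r = 0`, then there are no tuples `(x_1,…,x_{r-1})`, and no relations. -/
def PluckerFlagRel {F : Type u} [Tract F] {E : Type v} {w r : ℕ}
    (ν : (Fin w → E) → F) (μ : (Fin r → E) → F) : Prop :=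
  ∀ (q : ℕ) (hq : r = q + 1) (x : Fin q → E) (y : Fin (w + 1) → E),
    SumNull fun k : Fin (w + 1) =>
      eps F ^ (k.val + 1) * ν (k.removeNth y) *
        μ ((Fin.cons (y k) x : Fin (q + 1) → E) ∘ Fin.cast hq)

open Tract in
/-- The axioms (GP1)-(GP3) of a Grassmann-Plücker function of rank `r` on `E`. -/
structure IsGrassmannPlucker {F : Type u} [Tract F] {E : Type v} {r : ℕ}
    (φ : (Fin r → E) → F) : Prop where
  exists_ne_zero : ∃ x, φ x ≠ 0
  map_swap : ∀ (x : Fin r → E) (i j : Fin r), i ≠ j → φ (x ∘ Equiv.swap i j) = eps F * φ x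
  map_eq_zero : ∀ (x : Fin r → E) (i j : Fin r), i ≠ j → x i = x j → φ x = 0
  plucker : PluckerFlagRel φ φ

namespace IsGrassmannPlucker

variable {F : Type u} [Tract F] {E : Type v} {S : Type w} {r : ℕ} {φ : (Fin r → E) → F}

theorem injective (h : IsGrassmannPlucker φ) {x : Fin r → E} (hx : φ x ≠ 0) :
    Function.Injective x := by
  intro i j hij
  by_contra hne
  exact hx (h.map_eq_zero x i j hne hij)

theorem comp_perm_ne_zero (h : IsGrassmannPlucker φ) (σ : Equiv.Perm (Fin r)) :
    ∀ {x : Fin r → E}, φ x ≠ 0 → φ (x ∘ σ) ≠ 0 := by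
  induction σ using Equiv.Perm.swap_induction_on with
  | one => intro x hx; simpa using hx
  | swap_mul f i j hij ih =>
    intro x hx
    have h1 : φ (x ∘ Equiv.swap i j) ≠ 0 := by
      rw [h.map_swap x i j hij]
      exact mul_ne_zero (Units.ne_zero _) hx
    simpa [Equiv.Perm.coe_mul, Function.comp_assoc] using ih h1

theorem ne_zero_of_range_eq (h : IsGrassmannPlucker φ) {x y : Fin r → E} (hx : φ x ≠ 0)
    (hy : Function.Injective y) (hxy : Set.range y = Set.range x) : φ y ≠ 0 := by
  have hxi := h.injective hx
  let σ : Equiv.Perm (Fin r) := ((Equiv.ofInjective y hy).trans (Equiv.setCongr hxy)).trans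
    (Equiv.ofInjective x hxi).symm
  have hσ : y = x ∘ σ := by
    funext i
    have := Equiv.apply_ofInjective_symm hxi (Equiv.setCongr hxy (Equiv.ofInjective y hy i))
    simpa [σ] using this.symm
  rw [hσ]
  exact h.comp_perm_ne_zero σ hx

theorem exchange (h : IsGrassmannPlucker φ) :
    Matroid.ExchangeProperty fun B : Set E => ∃ x, φ x ≠ 0 ∧ Set.range x = B := by
  rintro _ _ ⟨x, hx, rfl⟩ ⟨y, hy, rfl⟩ a ⟨⟨i, rfl⟩, hay⟩
  obtain ⟨q, rfl⟩ : ∃ q, r = q + 1 := ⟨r - 1, by have := i.isLt; omega⟩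
  have hxi := h.injective hx
  have hcons : ∀ b : E, Set.range (Fin.cons b (i.removeNth x) : Fin (q + 1) → E)
      = insert b (Set.range x \ {x i}) := by
    intro b
    rw [Fin.range_cons]
    congr 1
    ext c
    simp only [Set.mem_range, Fin.removeNth, Set.mem_sdiff, Set.mem_singleton_iff]
    constructor
    · rintro ⟨k, rfl⟩
      exact ⟨⟨_, rfl⟩, fun hh => Fin.succAbove_ne i k (hxi hh)⟩
    · rintro ⟨⟨k, rfl⟩, hk⟩
      obtain ⟨l, rfl⟩ := Fin.exists_succAbove_eq (x := k) (y := i) (fun hh => hk (by rw [hh]))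
      exact ⟨l, rfl⟩
  have hne : φ (Fin.cons (x i) (i.removeNth x) : Fin (q + 1) → E) ≠ 0 := by
    refine h.ne_zero_of_range_eq hx ?_ ?_
    · rw [Fin.cons_injective_iff]
      refine ⟨?_, fun k l hkl => Fin.succAbove_right_injective (hxi hkl)⟩
      rintro ⟨k, hk⟩
      exact Fin.succAbove_ne i k (hxi hk)
    · rw [hcons, Set.insert_sdiff_singleton, Set.insert_eq_of_mem (Set.mem_range_self i)]
  by_contra hno
  have hpl := h.plucker q rfl (i.removeNth x) (Fin.cons (x i) y : Fin (q + 2) → E)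
  have hz : ∀ k : Fin (q + 1), φ (Fin.cons (y k) (i.removeNth x) : Fin (q + 1) → E) = 0 := by
    intro k
    by_contra hk
    refine hno ⟨y k, ⟨⟨k, rfl⟩, ?_⟩, Exists.intro _ (And.intro hk (hcons _))⟩
    rintro ⟨l, hl⟩
    have hinj := h.injective hk
    rw [Fin.cons_injective_iff] at hinj
    by_cases hli : l = i
    · subst hli
      exact hay ⟨k, hl.symm⟩
    · obtain ⟨m, rfl⟩ := Fin.exists_succAbove_eq hli
      exact hinj.1 ⟨m, hl⟩
  unfold Tract.SumNull at hpl
  rw [Fin.sum_univ_succ] at hpl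
  have h0 : ((0 : Fin (q + 2)).removeNth (Fin.cons (x i) y : Fin (q + 2) → E)) = y := by
    funext k; simp [Fin.removeNth]
  simp only [Fin.cons_succ, Fin.cons_zero, Fin.cast_refl, Function.comp_id, hz, mul_zero,
    Tract.term_zero, Finset.sum_const_zero, add_zero, h0] at hpl
  have hne2 : Tract.eps F ^ ((0 : Fin (q + 2)).val + 1) * φ y
      * φ (Fin.cons (x i) (i.removeNth x) : Fin (q + 1) → E) ≠ 0 :=
    mul_ne_zero (mul_ne_zero (pow_ne_zero _ (Units.ne_zero _)) hy) hne
  rw [Tract.term, dif_neg hne2] at hpl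
  have := Tract.single_mul_mem_nullset (Units.mk0 _ hne2)⁻¹ _ hpl
  rw [MonoidAlgebra.single_mul_single, inv_mul_cancel, mul_one] at this
  exact Tract.one_notMem_nullset this

/-- Fixing some of the arguments of a Grassmann-Plücker function, and pulling back the other
arguments along an injection, gives a Grassmann-Plücker function if the result is not zero. -/
theorem append {k m : ℕ} (hr : r = k + m) (h : IsGrassmannPlucker φ) {f : S → E} (a : Fin m → E)
    (hne : ∃ x : Fin k → S, φ (Fin.append (f ∘ x) a ∘ Fin.cast hr) ≠ 0) :
    IsGrassmannPlucker fun x : Fin k → S => φ (Fin.append (f ∘ x) a ∘ Fin.cast hr) := by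
  subst hr
  refine ⟨hne, ?_, ?_, ?_⟩
  · intro x i j hij
    have hc : Fin.castAdd m i ≠ Fin.castAdd m j := fun hh => hij (Fin.castAdd_injective _ _ hh)
    have := h.map_swap (Fin.append (f ∘ x) a) (Fin.castAdd m i) (Fin.castAdd m j) hc
    simp only [Fin.cast_refl, Function.comp_id]
    rw [← this]
    congr 1
    funext t
    refine Fin.addCases (fun t => ?_) (fun t => ?_) t
    · simp only [Fin.append_left, Function.comp_apply]
      by_cases h1 : t = i
      · subst h1; simp
      · by_cases h2 : t = j
        · subst h2; simp
        · rw [Equiv.swap_apply_of_ne_of_ne h1 h2, Equiv.swap_apply_of_ne_of_ne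
            (fun hh => h1 (Fin.castAdd_injective _ _ hh))
            (fun hh => h2 (Fin.castAdd_injective _ _ hh))]
          simp
    · have hn : ∀ l : Fin k, Fin.natAdd k t ≠ Fin.castAdd m l := by
        intro l hh
        have := congrArg Fin.val hh
        simp only [Fin.val_natAdd, Fin.val_castAdd] at this
        omega
      simp only [Fin.append_right, Function.comp_apply]
      rw [Equiv.swap_apply_of_ne_of_ne (hn i) (hn j)]
      simp
  · intro x i j hij hxx
    refine h.map_eq_zero _ (Fin.castAdd m i) (Fin.castAdd m j)
      (fun hh => hij (Fin.castAdd_injective _ _ hh)) ?_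
    simp [hxx]
  · rintro q rfl x y
    have hidx : (q + 1 + 1) + m = (q + 1 + m) + 1 := by omega
    have key := h.plucker (q + m) (by omega) (Fin.append (f ∘ x) a)
      (Fin.append (f ∘ y) a ∘ Fin.cast hidx.symm)
    unfold Tract.SumNull at key ⊢
    rw [← (finCongr hidx).sum_comp, Fin.sum_univ_add] at key
    beta_reduce at key ⊢
    have hcons : ∀ b : E, (Fin.cons b (Fin.append (f ∘ x) a) : Fin (q + m + 1) → E)
        ∘ Fin.cast (by omega : q + 1 + m = q + m + 1)
        = Fin.append (Fin.cons b (f ∘ x) : Fin (q + 1) → E) a := by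
      intro b
      rw [Fin.append_cons]
    rw [Finset.sum_eq_zero (s := Finset.univ (α := Fin m)), add_zero] at key
    · refine Eq.mp (congrArg (· ∈ _) (Finset.sum_congr rfl fun t _ => ?_)) key
      have h1 : (finCongr hidx (Fin.castAdd m t)).removeNth
          (Fin.append (f ∘ y) a ∘ Fin.cast hidx.symm) = Fin.append (f ∘ t.removeNth y) a := by
        funext l
        refine Fin.addCases (fun l => ?_) (fun l => ?_) l
        · have : Fin.cast hidx.symm ((finCongr hidx (Fin.castAdd m t)).succAbove (Fin.castAdd m l))
              = Fin.castAdd m (t.succAbove l) := by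
            ext
            simp only [Fin.succAbove, Fin.lt_def, finCongr_apply, Fin.val_cast, Fin.val_castAdd,
              Fin.val_castSucc]
            split_ifs <;> simp
          simp only [Fin.removeNth, Function.comp_apply, this, Fin.append_left]
        · have : Fin.cast hidx.symm
              ((finCongr hidx (Fin.castAdd m t)).succAbove (Fin.natAdd (q + 1) l))
              = Fin.natAdd (q + 1 + 1) l := by
            ext
            have := t.isLt
            simp only [Fin.succAbove, Fin.lt_def, finCongr_apply, Fin.val_cast, Fin.val_castAdd,
              Fin.val_castSucc, Fin.val_natAdd]
            split_ifs <;> simp <;> omega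
          simp only [Fin.removeNth, Function.comp_apply, this, Fin.append_right]
      rw [h1, hcons]
      have h2 : (Fin.append (f ∘ y) a ∘ Fin.cast hidx.symm) (finCongr hidx (Fin.castAdd m t))
          = f (y t) := by simp
      have h3 : f ∘ (Fin.cons (y t) x : Fin (q + 1) → S)
          = (Fin.cons (f (y t)) (f ∘ x) : Fin (q + 1) → E) := by
        funext l
        refine Fin.cases ?_ (fun l => ?_) l <;> simp
      rw [h2]
      simp [h3]
    · intro t _
      rw [hcons, h.map_eq_zero (Fin.append _ a) (Fin.castAdd m 0) (Fin.natAdd (q + 1) t)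
        (fun hh => ?_) (by simp), mul_zero, Tract.term_zero]
      have := congrArg Fin.val hh
      simp only [Fin.val_natAdd, Fin.val_castAdd, Fin.val_zero] at this
      omega

end IsGrassmannPlucker

/-- A Grassmann-Plücker function on `E` with coefficients in `F`, together with its rank. -/
structure GPFun (F : Type u) [Tract F] (E : Type v) where
  rank : ℕ
  toFun : (Fin rank → E) → F
  isGP : IsGrassmannPlucker toFun

namespace GPFun

variable {F : Type u} [Tract F] {E : Type v} {S : Type w}

/-- Two Grassmann-Plücker functions are equivalent if they have the same rank and differ by a
factor in `Fˣ`. -/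
def Equivalent (φ ψ : GPFun F E) : Prop :=
  ∃ h : φ.rank = ψ.rank, ∃ a : Fˣ, ∀ x : Fin φ.rank → E,
    φ.toFun x = a * ψ.toFun (x ∘ Fin.cast h.symm)

instance setoid (F : Type u) [Tract F] (E : Type v) : Setoid (GPFun F E) where
  r := Equivalent
  iseqv := by
    refine ⟨fun φ => ⟨rfl, 1, fun x => by simp⟩, ?_, ?_⟩
    · rintro ⟨r, f, hf⟩ ⟨r', g, hg⟩ ⟨h, a, ha⟩
      dsimp only at h
      subst h
      exact ⟨rfl, a⁻¹, fun x => by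
        have h1 := ha x
        simp only [Fin.cast_refl, Function.comp_id] at h1 ⊢
        rw [h1, Units.inv_mul_cancel_left]⟩
    · rintro ⟨r, f, hf⟩ ⟨r', g, hg⟩ ⟨r'', k, hk⟩ ⟨h, a, ha⟩ ⟨h', b, hb⟩
      dsimp only at h h'
      subst h
      subst h'
      exact ⟨rfl, a * b, fun x => by
        have h1 := ha x
        have h2 := hb x
        simp only [Fin.cast_refl, Function.comp_id] at h1 h2 ⊢
        rw [h1, h2, Units.val_mul, mul_assoc]⟩

/-- The underlying matroid: its bases are the sets `{x_1,…,x_r}` with `φ(x_1,…,x_r) ≠ 0`. -/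
def matroid (φ : GPFun F E) : Matroid E :=
  Matroid.ofExistsFiniteIsBase Set.univ (fun B => ∃ x, φ.toFun x ≠ 0 ∧ Set.range x = B)
    (by
      obtain ⟨x, hx⟩ := φ.isGP.exists_ne_zero
      exact ⟨_, ⟨x, hx, rfl⟩, Set.finite_range x⟩)
    φ.isGP.exchange (fun _ _ => Set.subset_univ _)

theorem matroid_isBase_iff (φ : GPFun F E) (B : Set E) :
    φ.matroid.IsBase B ↔ ∃ x, φ.toFun x ≠ 0 ∧ Set.range x = B := Iff.rfl

theorem matroid_ground (φ : GPFun F E) : φ.matroid.E = Set.univ := rfl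

theorem matroid_eq {φ ψ : GPFun F E} (h : Equivalent φ ψ) : φ.matroid = ψ.matroid := by
  obtain ⟨r, f, hf⟩ := φ
  obtain ⟨r', g, hg⟩ := ψ
  obtain ⟨h, a, ha⟩ := h
  dsimp only at h
  subst h
  refine Matroid.ext_isBase rfl fun B _ => ?_
  have h0 : ∀ x, f x ≠ 0 ↔ g x ≠ 0 := fun x => by
    have h1 := ha x
    simp only [Fin.cast_refl, Function.comp_id] at h1
    rw [h1]
    simp
  simp only [matroid_isBase_iff]
  exact exists_congr fun x => and_congr_left fun _ => h0 x

/-- An enumeration of a subset of a finite set. -/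
noncomputable def enum [Finite E] (I : Set E) : Fin I.ncard → E := fun i =>
  ((Finite.equivFin I).symm (Fin.cast (Nat.card_coe_set_eq I).symm i) : I)

theorem enum_injective [Finite E] (I : Set E) : Function.Injective (enum I) := by
  intro i j h
  exact Fin.cast_injective _ ((Finite.equivFin I).symm.injective (Subtype.val_injective h))

theorem range_enum [Finite E] (I : Set E) : Set.range (enum I) = I := by
  ext e
  constructor
  · rintro ⟨i, rfl⟩
    exact Subtype.coe_prop _
  · intro he
    exact ⟨Fin.cast (Nat.card_coe_set_eq I) (Finite.equivFin I ⟨e, he⟩),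
      congrArg Subtype.val ((Finite.equivFin I).symm_apply_apply ⟨e, he⟩)⟩

theorem range_append {m n : ℕ} (x : Fin m → E) (y : Fin n → E) :
    Set.range (Fin.append x y) = Set.range x ∪ Set.range y := by
  rw [← Set.Sum.elim_range, ← Fin.append_comp_sumElim]
  exact (finSumFinEquiv.surjective.range_comp (Fin.append x y)).symm

theorem ncard_isBase (φ : GPFun F E) {B : Set E} (hB : φ.matroid.IsBase B) :
    B.ncard = φ.rank := by
  obtain ⟨x, hx, rfl⟩ := hB
  rw [← Set.image_univ, Set.ncard_image_of_injective _ (φ.isGP.injective hx), Set.ncard_univ,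
    Nat.card_fin]

theorem ncard_le [Finite E] (φ : GPFun F E) {S I : Set E}
    (h : ∃ B, φ.matroid.IsBase B ∧ I ⊆ B ∧ B \ I ⊆ S) : φ.rank = φ.rank - I.ncard + I.ncard := by
  obtain ⟨B, hB, hI, -⟩ := h
  have := Set.ncard_le_ncard hI
  rw [φ.ncard_isBase hB] at this
  omega

/-- For `I = {a_1,…,a_m}`, the function `(x_1,…,x_{r-m}) ↦ φ(x_1,…,x_{r-m},a_1,…,a_m)` for
arguments `x_i` in `S`. The hypothesis says that this function is not identically zero. -/
noncomputable def fix [Finite E] (φ : GPFun F E) (S I : Set E)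
    (h : ∃ B, φ.matroid.IsBase B ∧ I ⊆ B ∧ B \ I ⊆ S) : GPFun F S where
  rank := φ.rank - I.ncard
  toFun x := φ.toFun (Fin.append (Subtype.val ∘ x) (enum I) ∘ Fin.cast (φ.ncard_le h))
  isGP := by
    refine IsGrassmannPlucker.append (φ.ncard_le h) φ.isGP (f := Subtype.val) (enum I) ?_
    have hle := φ.ncard_le h
    obtain ⟨B, hB, hI, hS⟩ := h
    have hc : (B \ I).ncard = φ.rank - I.ncard := by
      rw [Set.ncard_sdiff hI, φ.ncard_isBase hB]
    let x : Fin (φ.rank - I.ncard) → S := fun i =>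
      ⟨enum (B \ I) (Fin.cast hc.symm i), hS (by
        have : enum (B \ I) (Fin.cast hc.symm i) ∈ Set.range (enum (B \ I)) := ⟨_, rfl⟩
        rwa [range_enum] at this)⟩
    have hx : Subtype.val ∘ x = enum (B \ I) ∘ Fin.cast hc.symm := rfl
    have hxr : Set.range (Subtype.val ∘ x) = B \ I := by
      rw [hx]
      exact ((finCongr hc.symm).surjective.range_comp (enum (B \ I))).trans (range_enum _)
    refine ⟨x, ?_⟩
    obtain ⟨b, hb, rfl⟩ := hB
    refine φ.isGP.ne_zero_of_range_eq hb ?_ ?_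
    · refine Function.Injective.comp ?_ (finCongr hle).injective
      rw [Fin.append_injective_iff]
      refine ⟨?_, enum_injective I, ?_⟩
      · rw [hx]
        exact (enum_injective _).comp (finCongr hc.symm).injective
      · intro i j hij
        have h1 : (Subtype.val ∘ x) i ∈ Set.range (Subtype.val ∘ x) := ⟨i, rfl⟩
        have h2 : enum I j ∈ Set.range (enum I) := ⟨j, rfl⟩
        rw [hxr] at h1
        rw [range_enum] at h2
        exact h1.2 (hij ▸ h2)
    · refine ((finCongr hle).surjective.range_comp
        (Fin.append (Subtype.val ∘ x) (enum I))).trans ?_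
      rw [range_append, hxr, range_enum, Set.sdiff_union_of_subset hI]

theorem fix_equivalent [Finite E] {φ ψ : GPFun F E} (hφψ : Equivalent φ ψ) {S I J : Set E}
    (hIJ : I = J) (h h') : Equivalent (φ.fix S I h) (ψ.fix S J h') := by
  subst hIJ
  obtain ⟨r, f, hf⟩ := φ
  obtain ⟨r', g, hg⟩ := ψ
  obtain ⟨hr, a, ha⟩ := hφψ
  dsimp only at hr
  subst hr
  exact ⟨rfl, a, fun x => ha _⟩

/-- A maximal independent subset of `A`. -/
noncomputable def contractionSet (N : Matroid E) (A : Set E) : Set E :=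
  (N.exists_isBasis' A).choose

/-- A subset of `A` that is a basis of the contraction `N / (E - A)`. -/
noncomputable def deletionSet (N : Matroid E) (A : Set E) : Set E :=
  (N.contract Aᶜ).exists_isBase.choose

theorem contractionSet_spec (φ : GPFun F E) (A : Set E) :
    ∃ B, φ.matroid.IsBase B ∧ contractionSet φ.matroid A ⊆ B ∧
      B \ contractionSet φ.matroid A ⊆ Aᶜ := by
  have h : φ.matroid.IsBasis' (contractionSet φ.matroid A) A :=
    (φ.matroid.exists_isBasis' A).choose_spec
  obtain ⟨B, hB, hIB⟩ := h.indep.exists_isBase_superset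
  refine ⟨B, hB, hIB, fun e he heA => he.2 ?_⟩
  exact h.mem_of_insert_indep heA (hB.indep.subset (Set.insert_subset he.1 hIB))

theorem deletionSet_spec (φ : GPFun F E) (A : Set E) :
    ∃ B, φ.matroid.IsBase B ∧ deletionSet φ.matroid A ⊆ B ∧
      B \ deletionSet φ.matroid A ⊆ Aᶜ := by
  have h : (φ.matroid.contract Aᶜ).IsBase (deletionSet φ.matroid A) :=
    (φ.matroid.contract Aᶜ).exists_isBase.choose_spec
  obtain ⟨J, hJ⟩ := φ.matroid.exists_isBasis Aᶜ (Set.subset_univ _)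
  have hi := hJ.contract_indep_iff.1 h.indep
  obtain ⟨B, hB, hIB⟩ := hi.1.exists_isBase_superset
  refine ⟨B, hB, Set.subset_union_left.trans hIB, fun e he heA => he.2 ?_⟩
  refine h.mem_of_insert_indep (hJ.contract_indep_iff.2 ⟨hB.indep.subset ?_, ?_⟩)
  · exact Set.union_subset (Set.insert_subset he.1 (Set.subset_union_left.trans hIB))
      (Set.subset_union_right.trans hIB)
  · rw [Set.disjoint_insert_right]
    exact ⟨fun hh => hh heA, hi.2⟩

/-- The contraction `φ / A : (E - A)^{r - ℓ} → F`, given by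
`(x_1,…,x_{r-ℓ}) ↦ φ(x_1,…,x_{r-ℓ},a_1,…,a_ℓ)` for a maximal independent subset
`{a_1,…,a_ℓ}` of `A`. -/
noncomputable def contract [Finite E] (φ : GPFun F E) (A : Set E) : GPFun F ↥Aᶜ :=
  φ.fix Aᶜ (contractionSet φ.matroid A) (φ.contractionSet_spec A)

/-- The deletion `φ \ A : (E - A)^k → F`, given by
`(x_1,…,x_k) ↦ φ(x_1,…,x_k,a_1,…,a_{r-k})` for a basis `{a_1,…,a_{r-k}} ⊆ A` of the contraction
of the underlying matroid by `E - A`. -/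
noncomputable def delete [Finite E] (φ : GPFun F E) (A : Set E) : GPFun F ↥Aᶜ :=
  φ.fix Aᶜ (deletionSet φ.matroid A) (φ.deletionSet_spec A)

/-- Relabelling the elements of the ground set along a bijection. -/
def relabel (φ : GPFun F E) (f : E ≃ S) : GPFun F S where
  rank := φ.rank
  toFun x := φ.toFun (f.symm ∘ x)
  isGP := by
    have := IsGrassmannPlucker.append (m := 0) rfl φ.isGP (f := f.symm) Fin.elim0 (by
      obtain ⟨x, hx⟩ := φ.isGP.exists_ne_zero
      refine ⟨f ∘ x, ?_⟩
      rw [Fin.append_elim0]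
      convert hx using 2
      funext i
      simp)
    convert this using 2 with x
    rw [Fin.append_elim0]
    rfl

end GPFun

/-- An `F`-matroid on `E`: an equivalence class of Grassmann-Plücker functions. -/
def FMatroid (F : Type u) [Tract F] (E : Type v) : Type (max u v) :=
  Quotient (GPFun.setoid F E)

namespace FMatroid

variable {F : Type u} [Tract F] {E : Type v} {S : Type w}

/-- The `F`-matroid `M_φ = [φ]`. -/
def mk (φ : GPFun F E) : FMatroid F E := Quotient.mk _ φ

/-- The rank of an `F`-matroid. -/
def rank (M : FMatroid F E) : ℕ := 
  Quotient.lift GPFun.rank (fun φ ψ (h : GPFun.Equivalent φ ψ) => h.1) M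

/-- The contraction `M / A`, an `F`-matroid on `E - A`. -/
noncomputable def contract [Finite E] (M : FMatroid F E) (A : Set E) : FMatroid F ↥Aᶜ :=
  Quotient.map (fun φ => φ.contract A)
    (fun _ _ h => GPFun.fix_equivalent h (by rw [GPFun.matroid_eq h]) _ _) M

/-- The deletion `M \ A`, an `F`-matroid on `E - A`. -/
noncomputable def delete [Finite E] (M : FMatroid F E) (A : Set E) : FMatroid F ↥Aᶜ :=
  Quotient.map (fun φ => φ.delete A)
    (fun _ _ h => GPFun.fix_equivalent h (by rw [GPFun.matroid_eq h]) _ _) M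

/-- Relabelling the elements of the ground set along a bijection. -/
def relabel (M : FMatroid F E) (f : E ≃ S) : FMatroid F S :=
  Quotient.map (fun φ => φ.relabel f)
    (fun φ ψ (h : GPFun.Equivalent φ ψ) =>
      ⟨h.1, h.2.choose, fun x => h.2.choose_spec (f.symm ∘ x)⟩) M

/-- The minor `M \ I / J`, as an `F`-matroid on `(E - I) - J`. -/
noncomputable def minor [Finite E] (M : FMatroid F E) (I J : Set E) :
    FMatroid F ↥((Subtype.val ⁻¹' J : Set ↥Iᶜ)ᶜ) :=
  (M.delete I).contract (Subtype.val ⁻¹' J)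

/-- `IsQuotient N M` says that `M` is a quotient of `N`, written `N ↠ M`. -/
def IsQuotient (N M : FMatroid F E) : Prop :=
  ∀ μ ν : GPFun F E, mk μ = M → mk ν = N → PluckerFlagRel ν.toFun μ.toFun

/-- A flag `F`-matroid `(M_1,…,M_s)` on `E`: a sequence with `M_j ↠ M_i` for all `i < j`. -/
def IsFlag {s : ℕ} (M : Fin s → FMatroid F E) : Prop :=
  ∀ i j : Fin s, i < j → IsQuotient (M j) (M i)

/-- The rank `(r_1,…,r_s)` of a flag `F`-matroid. -/
def flagRank {s : ℕ} (M : Fin s → FMatroid F E) : Fin s → ℕ := fun i => (M i).rank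

end FMatroid

namespace GPFun

open Tract

variable {F : Type u} [Tract F] {E : Type v}

/-- The set of nonzero multiples of the elements `X_C` of `F^E`, where `C` runs through the
circuits of the matroid `N`. For `y_0 ∈ C` and a basis `{y_1,…,y_r}` of `N` that contains
`C - y_0`, one has `X_C(y_i) = ε^i φ(y_0,…,ŷ_i,…,y_r)`, and `X_C` is zero elsewhere. -/
def signedCircuits (N : Matroid E) {r : ℕ} (φ : (Fin r → E) → F) : Set (E → F) :=
  {X | ∃ (C : Set E) (y : Fin (r + 1) → E) (a : Fˣ), N.IsCircuit C ∧ y 0 ∈ C ∧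
    N.IsBase (Set.range (Fin.tail y)) ∧ C \ {y 0} ⊆ Set.range (Fin.tail y) ∧
    (∀ i : Fin (r + 1), X (y i) = a * (eps F ^ i.val * φ (i.removeNth y))) ∧
    ∀ e, e ∉ Set.range y → X e = 0}

/-- The set `C(M)` of `F`-circuits of `M = M_φ`. -/
def circuits (φ : GPFun F E) : Set (E → F) := signedCircuits φ.matroid φ.toFun

theorem rank_le {n : ℕ} (φ : GPFun F (Fin n)) : φ.rank ≤ n := by
  obtain ⟨x, hx⟩ := φ.isGP.exists_ne_zero
  simpa using Fintype.card_le_of_injective x (φ.isGP.injective hx)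

open Classical in
/-- The dual `φ^* : E^{n-r} → F` for `E = {1,…,n}`. If `(x,x') = (x_1,…,x_{n-r},x'_1,…,x'_r)` is
an ordering `σ` of `E`, then `φ^*(x) = sign(σ) · τ(φ(x'))`. If `x` does not extend to an
ordering of `E`, then `φ^*(x) = 0`. -/
noncomputable def dualFun {n : ℕ} (τ : Involution F) (φ : GPFun F (Fin n)) :
    (Fin (n - φ.rank) → Fin n) → F := fun x =>
  if h : ∃ σ : Equiv.Perm (Fin n), ∀ i : Fin (n - φ.rank), σ ⟨i, by omega⟩ = x i then
    (if Equiv.Perm.sign h.choose = 1 then 1 else eps F) *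
      τ.toFun (φ.toFun fun j : Fin φ.rank =>
        h.choose ⟨n - φ.rank + j, by have := φ.rank_le; omega⟩)
  else 0

/-- The set `C^*(M) = C(M^*)` of `F`-cocircuits of `M = M_φ`, where `M^* = M_{φ^*}`. The underlying
matroid of `M^*` is the dual of the underlying matroid of `M`. -/
noncomputable def cocircuits {n : ℕ} (τ : Involution F) (φ : GPFun F (Fin n)) :
    Set (Fin n → F) :=
  signedCircuits φ.matroid.dual (φ.dualFun τ)

end GPFun

namespace Tract

variable {F : Type u} [Tract F]

/-- Orthogonality of `X` and `Y` in `F^E`: the formal sum `∑ i, X_i · τ(Y_i)` is in `N_F`. -/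
def Orthogonal (τ : Involution F) {n : ℕ} (X Y : Fin n → F) : Prop :=
  SumNull fun i => X i * τ.toFun (Y i)

/-- The orthogonal complement of a subset of `F^E`. -/
def orthogonalComplement (τ : Involution F) {n : ℕ} (𝒳 : Set (Fin n → F)) : Set (Fin n → F) :=
  {X | ∀ Y ∈ 𝒳, Orthogonal τ X Y}

/-- The set `V(M) = C^*(M)^⊥` of `F`-vectors of `M = M_φ`. -/
noncomputable def vectors (τ : Involution F) {n : ℕ} (φ : GPFun F (Fin n)) : Set (Fin n → F) :=
  orthogonalComplement τ (φ.cocircuits τ)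

/-- The set `V^*(M) = C(M)^⊥` of `F`-covectors of `M = M_φ`. -/
def covectors (τ : Involution F) {n : ℕ} (φ : GPFun F (Fin n)) : Set (Fin n → F) :=
  orthogonalComplement τ φ.circuits

/-- A tract `F` is perfect if `V(M) ⊥ V^*(M)` for every `F`-matroid `M = M_φ` on a set
`{1,…,n}`. -/
def IsPerfect (τ : Involution F) : Prop :=
  ∀ (n : ℕ) (φ : GPFun F (Fin n)), ∀ X ∈ vectors τ φ, ∀ Y ∈ covectors τ φ, Orthogonal τ X Y

end Tract

/-- The first `m` of the `p` new elements of `E ⊔ {1,…,p}`. -/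
def firstNew (E : Type v) (p m : ℕ) : Set (E ⊕ Fin p) := Sum.inr '' {k | k.val < m}

/-- The new elements of `E ⊔ {1,…,p}` except for the first `m`. -/
def lastNew (E : Type v) (p m : ℕ) : Set (E ⊕ Fin p) := Sum.inr '' {k | m ≤ k.val}

/-- The elements that are left over when all the new elements of `E ⊔ {1,…,p}` are removed are
the elements of `E`. -/
def removeNewEquiv (E : Type v) (p m : ℕ) :
    ↥((Subtype.val ⁻¹' firstNew E p m : Set ↥(lastNew E p m)ᶜ)ᶜ) ≃ E where
  toFun
    | ⟨⟨Sum.inl e, _⟩, _⟩ => e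
    | ⟨⟨Sum.inr k, h⟩, h'⟩ => False.elim <| by
        rcases lt_or_ge k.val m with hk | hk
        · exact h' ⟨k, hk, rfl⟩
        · exact h ⟨k, hk, rfl⟩
  invFun e := ⟨⟨Sum.inl e, by simp [lastNew]⟩, by simp [firstNew]⟩
  left_inv := by
    rintro ⟨⟨e | k, h⟩, h'⟩
    · rfl
    · exfalso
      rcases lt_or_ge k.val m with hk | hk
      · exact h' ⟨k, hk, rfl⟩
      · exact h ⟨k, hk, rfl⟩
  right_inv _ := rfl

/-- The elements of `E ⊔ {e}` different from the new element `e` (written `none`) are the elements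
of `E`. -/
def removeNoneEquiv (E : Type v) : ↥({none}ᶜ : Set (Option E)) ≃ E where
  toFun
    | ⟨some e, _⟩ => e
    | ⟨none, h⟩ => False.elim (h rfl)
  invFun e := ⟨some e, by simp⟩
  left_inv := by
    rintro ⟨_ | e, h⟩
    · exact False.elim (h rfl)
    · rfl
  right_inv _ := rfl

/-- The sequence `(M / e, M \ e)` of `F`-matroids on `E`, for an `F`-matroid `M` on
`E ⊔ {e}`. -/
noncomputable def FMatroid.contractDelete {F : Type u} [Tract F] {E : Type v} [Finite E]
    (M : FMatroid F (Option E)) : Fin 2 → FMatroid F E :=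
  ![(M.contract {none}).relabel (removeNoneEquiv E), (M.delete {none}).relabel (removeNoneEquiv E)]

/-! The two statements are independent of each other.

Flags of minors: both $M_i$ and $M_j$ with $i<j$ arise from one Grassmann–Plücker function $\varphi$
of $M'$ by fixing arguments, say $\mu=\varphi(\cdot,b)$ and $\nu=\varphi(\cdot,a)$. Write the
Plücker relation of $\varphi$ for the tuples $(y,a)$ and $(x,b)$. The terms that move some $y_k$
form the flag relation. A term that moves some $a_t$ vanishes: if $a_t$ was fixed by the contraction
in $M_j$, then it occurs in $b$ or enlarges a maximal independent set inside $b$; if it was fixed by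
the deletion, then no basis inside $E\cup a$ can omit it (`pluckerFlagRel_append`, `isFlag_minor`).

Lifts of $(M_\mu,M_\nu)$: comparing ranks shows that a lift has rank $r+1$. After scaling, it is
represented by the alternating function with values $\nu(x)$ at $x$ and $c\mu(x)$ at $(e,x)$, for a
unit $c$. This function is `glue`, and $c$ is determined by the class, because the tuples without
$e$ fix the scaling. So lifts correspond to units as soon as every `glue` satisfies the Plücker
relations.

Its three-term relations come from those of $\mu$ and $\nu$ and from the flag relations between them
(`threeTerm_glue`), and its support has the exchange property for the same reasons
(`exchangeProperty_glue`). Perfection is what leads from there to all Plücker relations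
(`pluckerAt_of_threeNull`). In the relation for $y$ and $x=(a,A)$ with $a$ not in $y$, consider the
rank $2$ function $\psi(i,j)=\varphi(y_i,y_j,A)$ on the indices of $y$. By the three-term relations
it is a Grassmann–Plücker function if it is not zero, and $i\mapsto\varphi(y_i,a,A)$ gives a
covector. By induction on the number of entries of $x$ outside $y$,
$i\mapsto\epsilon^i\varphi(y\setminus y_i)$ is a vector. Their orthogonality is the desired
relation. If $\psi=0$, the exchange property makes every term vanish. -/

section

open Tract

/-! ### Signs and null sums in a tract -/

namespace Tract

variable {F : Type u} [Tract F]

theorem eps_ne_zero : eps F ≠ 0 := Units.ne_zero _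

theorem one_add_epsUnit_mem :
    (1 : MonoidAlgebra ℕ Fˣ) + MonoidAlgebra.single (epsUnit F) 1 ∈ nullset :=
  (existsUnique_eps (F := F)).choose_spec.1

theorem eq_epsUnit {a : Fˣ} (ha : (1 : MonoidAlgebra ℕ Fˣ) + MonoidAlgebra.single a 1 ∈ nullset) :
    a = epsUnit F :=
  (existsUnique_eps (F := F)).choose_spec.2 a ha

/-- Multiplying $1+\epsilon$ by $\epsilon^{-1}$ gives the null sum $\epsilon^{-1}+1$, so
$\epsilon^{-1}=\epsilon$ by uniqueness. -/
theorem eps_mul_eps : eps F * eps F = 1 := by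
  have h := single_mul_mem_nullset (epsUnit F)⁻¹ _ (one_add_epsUnit_mem (F := F))
  rw [mul_add, MonoidAlgebra.single_mul_single, inv_mul_cancel, mul_one, mul_one, add_comm] at h
  have h1 := eq_epsUnit h
  have h2 : epsUnit F * epsUnit F = 1 := by
    nth_rewrite 1 [← h1]
    exact inv_mul_cancel _
  exact congrArg Units.val h2

theorem eps_mul_eps_mul (a : F) : eps F * (eps F * a) = a := by
  rw [← mul_assoc, eps_mul_eps, one_mul]

theorem term_unit (a : Fˣ) : term (a : F) = MonoidAlgebra.single a 1 := by
  simp [term]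

theorem term_one : term (1 : F) = 1 := term_unit 1

theorem term_mul (a b : F) : term (a * b) = term a * term b := by
  by_cases ha : a = 0
  · simp [ha]
  by_cases hb : b = 0
  · simp [hb]
  lift a to Fˣ using isUnit_iff_ne_zero.2 ha
  lift b to Fˣ using isUnit_iff_ne_zero.2 hb
  rw [← Units.val_mul, term_unit, term_unit, term_unit, MonoidAlgebra.single_mul_single, mul_one]

theorem term_notMem_nullset {a : F} (ha : a ≠ 0) : term a ∉ nullset := by
  lift a to Fˣ using isUnit_iff_ne_zero.2 ha
  intro h
  have := single_mul_mem_nullset a⁻¹ _ h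
  rw [term_unit, MonoidAlgebra.single_mul_single, inv_mul_cancel, mul_one] at this
  exact one_notMem_nullset this

theorem term_mul_mem_nullset (a : F) {x : MonoidAlgebra ℕ Fˣ} (hx : x ∈ nullset) :
    term a * x ∈ nullset := by
  by_cases ha : a = 0
  · simpa [ha] using zero_mem_nullset
  lift a to Fˣ using isUnit_iff_ne_zero.2 ha
  rw [term_unit]
  exact single_mul_mem_nullset _ _ hx

theorem term_add_eps_mul_mem (a : F) : term a + term (eps F * a) ∈ nullset := by
  have h := term_mul_mem_nullset a (one_add_epsUnit_mem (F := F))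
  rwa [mul_add, mul_one, ← term_unit, ← term_mul, mul_comm a] at h

namespace SumNull

variable {ι : Type*} [Fintype ι] {κ : Type*} [Fintype κ]

theorem of_forall_eq_zero {a : ι → F} (h : ∀ i, a i = 0) : SumNull a := by
  simp [SumNull, h, zero_mem_nullset]

theorem mul_left {a : ι → F} (c : F) (h : SumNull a) : SumNull fun i => c * a i := by
  simpa only [SumNull, term_mul, ← Finset.mul_sum] using term_mul_mem_nullset c h

theorem mul_left_iff {a : ι → F} {c : F} (hc : c ≠ 0) :
    (SumNull fun i => c * a i) ↔ SumNull a := by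
  refine ⟨fun h => ?_, mul_left c⟩
  simpa [← mul_assoc, inv_mul_cancel₀ hc] using h.mul_left c⁻¹

theorem comp_equiv_iff (e : κ ≃ ι) {a : ι → F} : SumNull (fun k => a (e k)) ↔ SumNull a := by
  simp only [SumNull, e.sum_comp fun i => term (a i)]

theorem comp_injective_iff {e : κ → ι} (he : Function.Injective e) {a : ι → F}
    (h : ∀ i ∉ Set.range e, a i = 0) : SumNull (fun k => a (e k)) ↔ SumNull a := by
  simp only [SumNull]
  rw [Fintype.sum_of_injective e he (fun k => term (a (e k))) (fun i => term (a i))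
    (fun i hi => by simp [h i hi]) fun _ => rfl]

/-- A single unit is never null, since a multiple of it is $1$. This is how a Plücker relation
yields an exchange of basis elements. -/
theorem exists_ne_zero {a : ι → F} (h : SumNull a) {i : ι} (hi : a i ≠ 0) :
    ∃ j, j ≠ i ∧ a j ≠ 0 := by
  classical
  by_contra! hno
  refine term_notMem_nullset hi ?_
  rwa [SumNull, Finset.sum_eq_single i (fun j _ hj => by simp [hno j hj]) (by simp)] at h

end SumNull

namespace Involution

variable (τ : Involution F)

theorem map_ne_zero {a : F} (ha : a ≠ 0) : τ.toFun a ≠ 0 := fun h =>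
  ha (by rw [← τ.invol a, h, τ.map_zero])

theorem map_sumNull {ι : Type*} [Fintype ι] {a : ι → F} (h : SumNull a) :
    SumNull fun i => τ.toFun (a i) :=
  (SumNull.comp_equiv_iff (Fintype.equivFin ι).symm).1
    (τ.map_null _ _ ((SumNull.comp_equiv_iff (Fintype.equivFin ι).symm).2 h))

/-- Applying $\tau$ to $1+\epsilon$ gives the null sum $1+\tau(\epsilon)$, and $\epsilon$ is unique.
-/
theorem map_eps : τ.toFun (eps F) = eps F := by
  have h : SumNull ![1, eps F] := by
    simpa [SumNull, Fin.sum_univ_two] using term_add_eps_mul_mem (1 : F)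
  have h1 := τ.map_sumNull h
  simp only [SumNull, Fin.sum_univ_two, Matrix.cons_val_zero, Matrix.cons_val_one, τ.map_one,
    term_one] at h1
  obtain ⟨a, ha⟩ := isUnit_iff_ne_zero.2 (τ.map_ne_zero (eps_ne_zero (F := F)))
  rw [← ha, term_unit] at h1
  rw [← ha, eq_epsUnit h1]
  rfl

end Involution

/-- The homomorphism `ℤˣ → F` that sends `-1` to `ε`. -/
noncomputable def epsSign (F : Type u) [Tract F] : ℤˣ →* F where
  toFun s := if s = 1 then 1 else eps F
  map_one' := if_pos rfl
  map_mul' s t := by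
    rcases Int.units_eq_one_or s with rfl | rfl <;> rcases Int.units_eq_one_or t with rfl | rfl <;>
      simp [eps_mul_eps]

theorem epsSign_apply (s : ℤˣ) : epsSign F s = if s = 1 then 1 else eps F := rfl

theorem epsSign_neg_one : epsSign F (-1) = eps F := by simp [epsSign_apply]

theorem epsSign_ne_zero (s : ℤˣ) : epsSign F s ≠ 0 := by
  rw [epsSign_apply]
  split_ifs
  exacts [one_ne_zero, eps_ne_zero]

theorem epsSign_mul_self (s : ℤˣ) : epsSign F s * epsSign F s = 1 := by
  rw [← map_mul, Int.units_mul_self, map_one]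

theorem Involution.map_epsSign (τ : Involution F) (s : ℤˣ) :
    τ.toFun (epsSign F s) = epsSign F s := by
  rw [epsSign_apply]
  split_ifs
  exacts [τ.map_one, τ.map_eps]

/-- The sign of a permutation as an element of a tract. -/
noncomputable def permSign (F : Type u) [Tract F] {n : ℕ} (σ : Equiv.Perm (Fin n)) : F :=
  epsSign F σ.sign

theorem permSign_mul {n : ℕ} (σ ρ : Equiv.Perm (Fin n)) :
    permSign F (σ * ρ) = permSign F σ * permSign F ρ := by
  simp [permSign]

theorem permSign_inv {n : ℕ} (σ : Equiv.Perm (Fin n)) : permSign F σ⁻¹ = permSign F σ := by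
  simp [permSign]

theorem permSign_ne_zero {n : ℕ} (σ : Equiv.Perm (Fin n)) : permSign F σ ≠ 0 :=
  epsSign_ne_zero _

theorem permSign_mul_self {n : ℕ} (σ : Equiv.Perm (Fin n)) :
    permSign F σ * permSign F σ = 1 := epsSign_mul_self _

theorem permSign_cycleRange {n : ℕ} (i : Fin n) : permSign F i.cycleRange = eps F ^ i.val := by
  rw [permSign, Fin.sign_cycleRange, map_pow, epsSign_neg_one]

theorem permSign_cycleRange_symm {n : ℕ} (i : Fin n) :
    permSign F i.cycleRange.symm = eps F ^ i.val := by
  rw [← permSign_cycleRange]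
  exact permSign_inv _

end Tract

/-! ### Alternating functions and permutation signs -/

/-- An alternating function with values in a tract. -/
structure IsAlternatingFun {F : Type u} [Tract F] {V : Type v} {n : ℕ}
    (φ : (Fin n → V) → F) : Prop where
  map_swap : ∀ (x : Fin n → V) (i j : Fin n), i ≠ j → φ (x ∘ Equiv.swap i j) = eps F * φ x
  map_eq_zero : ∀ (x : Fin n → V) (i j : Fin n), i ≠ j → x i = x j → φ x = 0

theorem IsGrassmannPlucker.isAlternatingFun {F : Type u} [Tract F] {V : Type v} {n : ℕ}
    {φ : (Fin n → V) → F} (h : IsGrassmannPlucker φ) : IsAlternatingFun φ :=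
  ⟨h.map_swap, h.map_eq_zero⟩

theorem Fin.comp_cycleRange_symm {V : Type v} {n : ℕ} (x : Fin (n + 1) → V) (i : Fin (n + 1)) :
    x ∘ i.cycleRange.symm = Fin.cons (x i) (i.removeNth x) := by
  funext j
  refine Fin.cases ?_ (fun j => ?_) j
  · simp
  · simp [Fin.removeNth]

namespace IsAlternatingFun

variable {F : Type u} [Tract F] {V : Type v} {n : ℕ} {φ : (Fin n → V) → F}

theorem comp_perm (h : IsAlternatingFun φ) (σ : Equiv.Perm (Fin n)) :
    ∀ x : Fin n → V, φ (x ∘ σ) = permSign F σ * φ x := by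
  induction σ using Equiv.Perm.swap_induction_on with
  | one => intro x; simp [permSign]
  | swap_mul f i j hij ih =>
    intro x
    have := ih (x ∘ Equiv.swap i j)
    rw [h.map_swap x i j hij] at this
    rw [Equiv.Perm.coe_mul, ← Function.comp_assoc, this, permSign_mul, permSign, permSign,
      Equiv.Perm.sign_swap hij, epsSign_neg_one, mul_left_comm, mul_assoc]

theorem injective (h : IsAlternatingFun φ) {x : Fin n → V} (hx : φ x ≠ 0) :
    Function.Injective x := by
  intro i j hij
  by_contra hne
  exact hx (h.map_eq_zero x i j hne hij)

theorem eq_zero_of_not_injective (h : IsAlternatingFun φ) {x : Fin n → V}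
    (hx : ¬ Function.Injective x) : φ x = 0 := by
  by_contra h0
  exact hx (h.injective h0)

theorem ne_zero_of_range_eq (h : IsAlternatingFun φ) {x y : Fin n → V} (hx : φ x ≠ 0)
    (hy : Function.Injective y) (hxy : Set.range y = Set.range x) : φ y ≠ 0 := by
  have hxi := h.injective hx
  let σ : Equiv.Perm (Fin n) := ((Equiv.ofInjective y hy).trans (Equiv.setCongr hxy)).trans
    (Equiv.ofInjective x hxi).symm
  have hσ : y = x ∘ σ := by
    funext i
    have := Equiv.apply_ofInjective_symm hxi (Equiv.setCongr hxy (Equiv.ofInjective y hy i))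
    simpa [σ] using this.symm
  rw [hσ, h.comp_perm]
  exact mul_ne_zero (permSign_ne_zero _) hx

theorem cons_removeNth {φ : (Fin (n + 1) → V) → F} (h : IsAlternatingFun φ)
    (x : Fin (n + 1) → V) (i : Fin (n + 1)) :
    φ (Fin.cons (x i) (i.removeNth x) : Fin (n + 1) → V) = eps F ^ i.val * φ x := by
  rw [← Fin.comp_cycleRange_symm, h.comp_perm, permSign_cycleRange_symm]

theorem swap_cons_cons {φ : (Fin (n + 2) → V) → F} (h : IsAlternatingFun φ) (a b : V)
    (x : Fin n → V) :
    φ (Fin.cons a (Fin.cons b x : Fin (n + 1) → V) : Fin (n + 2) → V)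
      = eps F * φ (Fin.cons b (Fin.cons a x : Fin (n + 1) → V) : Fin (n + 2) → V) := by
  rw [← h.map_swap _ 0 1 (by simp)]
  congr 1
  funext i
  refine Fin.cases ?_ (fun i => Fin.cases ?_ (fun i => ?_) i) i
  · simp
  · simp
  · rw [Function.comp_apply, Equiv.swap_apply_of_ne_of_ne]
    · simp
    · exact Fin.succ_ne_zero _
    · intro hh
      have := congrArg Fin.val hh
      simp at this

theorem cons_self {φ : (Fin (n + 1) → V) → F} (h : IsAlternatingFun φ) {a : V}
    {x : Fin n → V} (ha : a ∈ Set.range x) : φ (Fin.cons a x : Fin (n + 1) → V) = 0 := by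
  obtain ⟨i, rfl⟩ := ha
  exact h.map_eq_zero _ 0 i.succ (Fin.succ_ne_zero _).symm (by simp)

/-- The expression `sign(ρ) φ(x_{ρ 1},…,x_{ρ n})` depends only on `ρ 0`. -/
theorem permSign_mul_tail (h : IsAlternatingFun φ) (x : Fin (n + 1) → V)
    {σ ρ : Equiv.Perm (Fin (n + 1))} (h0 : σ 0 = ρ 0) :
    permSign F σ * φ (Fin.tail (x ∘ σ)) = permSign F ρ * φ (Fin.tail (x ∘ ρ)) := by
  obtain ⟨⟨p, π⟩, hπ⟩ := Equiv.Perm.decomposeFin.symm.surjective (ρ⁻¹ * σ)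
  have hp : p = 0 := by
    have := congrArg (fun e : Equiv.Perm (Fin (n + 1)) => e 0) hπ
    simpa [h0] using this
  subst hp
  have hσ : σ = ρ * Equiv.Perm.decomposeFin.symm (0, π) := by rw [hπ, mul_inv_cancel_left]
  have h1 : Fin.tail (x ∘ σ) = Fin.tail (x ∘ ρ) ∘ π := by
    funext i
    simp [hσ, Fin.tail, Equiv.Perm.decomposeFin_symm_apply_succ]
  have h2 : permSign F σ = permSign F ρ * permSign F π := by
    rw [hσ, permSign_mul, permSign, permSign, permSign, Equiv.Perm.decomposeFin.symm_sign]
    simp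
  rw [h1, h2, h.comp_perm, mul_assoc, ← mul_assoc (permSign F π), permSign_mul_self, one_mul]

theorem permSign_mul_tail_eq (h : IsAlternatingFun φ) (x : Fin (n + 1) → V)
    (σ : Equiv.Perm (Fin (n + 1))) :
    permSign F σ * φ (Fin.tail (x ∘ σ)) = eps F ^ (σ 0).val * φ ((σ 0).removeNth x) := by
  rw [h.permSign_mul_tail x (σ := σ) (ρ := (σ 0).cycleRange.symm) (by simp),
    Fin.comp_cycleRange_symm, permSign_cycleRange_symm, Fin.tail_cons]

/-- Both sides compute the same signed tail, for the ordering of `x` that first applies `σ` and then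
brings position `k` to the front. It makes a Plücker relation independent of the order of the tuple
from which entries are omitted. -/
theorem removeNth_comp_perm (h : IsAlternatingFun φ) (x : Fin (n + 1) → V)
    (σ : Equiv.Perm (Fin (n + 1))) (k : Fin (n + 1)) :
    eps F ^ k.val * φ (k.removeNth (x ∘ σ))
      = permSign F σ * (eps F ^ (σ k).val * φ ((σ k).removeNth x)) := by
  have h1 := h.permSign_mul_tail_eq (x ∘ σ) k.cycleRange.symm
  have h2 := h.permSign_mul_tail_eq x (σ * k.cycleRange.symm)
  simp only [Equiv.Perm.coe_mul, Function.comp_apply, Fin.cycleRange_symm_zero,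
    permSign_mul] at h1 h2
  rw [← h1, ← h2, ← mul_assoc, ← mul_assoc, permSign_mul_self, one_mul, Function.comp_assoc]

end IsAlternatingFun

/-! ### Duals, circuits and cocircuits -/

theorem Equiv.Perm.exists_perm_natAdd {m r n : ℕ} (h : n = m + r) (δ : Equiv.Perm (Fin n))
    (hδ : ∀ i, i.val < m → δ i = i) :
    ∃ π : Equiv.Perm (Fin r), π.sign = δ.sign ∧
      ∀ j : Fin r, δ ⟨m + j, by omega⟩ = ⟨m + π j, by omega⟩ := by
  subst h
  let e : {i : Fin (m + r) // m ≤ i.val} ≃ Fin r :=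
    { toFun := fun i => ⟨i.1 - m, by omega⟩
      invFun := fun j => ⟨⟨m + j, by omega⟩, by simp⟩
      left_inv := fun i => by
        have := i.2
        ext
        simp only
        omega
      right_inv := fun j => by ext; simp }
  have h1 : ∀ i : Fin (m + r), m ≤ (δ i).val ↔ m ≤ i.val := by
    intro i
    rw [← not_lt, ← not_lt, not_iff_not]
    constructor
    · intro hi
      rwa [← δ.injective (hδ _ hi)]
    · intro hi
      rwa [hδ _ hi]
  refine ⟨e.permCongr (δ.subtypePerm h1), ?_, fun j => ?_⟩
  · rw [Equiv.Perm.sign_permCongr, Equiv.Perm.sign_subtypePerm]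
    intro i hi
    by_contra hlt
    exact hi (hδ _ (not_le.1 hlt))
  · have := (h1 ⟨m + j, by omega⟩).2 (by simp)
    ext
    simp only [permCongr_apply, coe_fn_mk, subtypePerm_apply, e, coe_fn_symm_mk]
    omega

namespace GPFun

variable {F : Type u} [Tract F]

/-- Frees the dual from the chosen ordering. Two orderings extending `x` differ by a permutation of
the complementary block; its sign appears once in the sign of the ordering and once by alternation
of `ψ`, and it cancels because it squares to $1$ and is fixed by `τ`. -/
theorem dualFun_eq {n : ℕ} (τ : Involution F) (ψ : GPFun F (Fin n))
    {x : Fin (n - ψ.rank) → Fin n} (σ : Equiv.Perm (Fin n))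
    (hσ : ∀ i : Fin (n - ψ.rank), σ ⟨i, by omega⟩ = x i) :
    ψ.dualFun τ x = permSign F σ * τ.toFun (ψ.toFun fun j : Fin ψ.rank =>
        σ ⟨n - ψ.rank + j, by have := ψ.rank_le; omega⟩) := by
  have h : ∃ σ : Equiv.Perm (Fin n), ∀ i : Fin (n - ψ.rank), σ ⟨i, by omega⟩ = x i := ⟨σ, hσ⟩
  have hr := ψ.rank_le
  rw [dualFun, dif_pos h]
  generalize_proofs _ hp
  have hρ := h.choose_spec
  set ρ := h.choose
  obtain ⟨π, hπ, hπ'⟩ := Equiv.Perm.exists_perm_natAdd (m := n - ψ.rank) (r := ψ.rank)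
    (by omega) (σ⁻¹ * ρ) (by
      intro i hi
      have h1 := hρ ⟨i, hi⟩
      have h2 := hσ ⟨i, hi⟩
      rw [Equiv.Perm.mul_apply, Equiv.Perm.inv_eq_iff_eq]
      exact h1.trans h2.symm)
  have h1 : (fun j : Fin ψ.rank => ρ ⟨n - ψ.rank + j, hp j⟩)
      = (fun j : Fin ψ.rank => σ ⟨n - ψ.rank + j, hp j⟩) ∘ π := by
    funext j
    have := hπ' j
    rw [Equiv.Perm.mul_apply, Equiv.Perm.inv_eq_iff_eq] at this
    exact this
  have h2 : permSign F ρ = permSign F σ * permSign F π := by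
    have : ρ = σ * (σ⁻¹ * ρ) := by rw [mul_inv_cancel_left]
    conv_lhs => rw [this]
    rw [permSign_mul]
    simp only [permSign, hπ]
  change permSign F ρ * _ = _
  rw [h1, ψ.isGP.isAlternatingFun.comp_perm, τ.map_mul, h2, mul_assoc]
  congr 1
  rw [permSign, τ.map_epsSign, ← mul_assoc, epsSign_mul_self, one_mul]

/-- If $y_0$ were among the remaining entries, the circuit would lie inside a basis. -/
theorem injective_of_isBase_tail {V : Type v} {N : Matroid V} {C : Set V} {m : ℕ}
    {y : Fin (m + 1) → V} (hC : N.IsCircuit C)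
    (hB : N.IsBase (Set.range (Fin.tail y))) (hCB : C \ {y 0} ⊆ Set.range (Fin.tail y))
    (ht : Function.Injective (Fin.tail y)) : Function.Injective y := by
  rw [← Fin.cons_self_tail y, Fin.cons_injective_iff]
  refine ⟨fun h => hC.not_indep (hB.indep.subset fun c hc => ?_), ht⟩
  by_cases hc0 : c = y 0
  · rwa [hc0]
  · exact hCB ⟨hc, hc0⟩

theorem injective_of_ncard_range {V : Type v} {m : ℕ} {y : Fin m → V}
    (h : (Set.range y).ncard = m) : Function.Injective y := by
  have h1 : (Set.univ : Set (Fin m)).InjOn y := by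
    refine Set.injOn_of_ncard_image_eq ?_
    rw [Set.image_univ, h, Set.ncard_univ, Nat.card_fin]
  exact Set.injOn_univ.1 h1

theorem exists_of_mem_circuits {V : Type v} {φ : GPFun F V} {X : V → F}
    (hX : X ∈ φ.circuits) : ∃ (y : Fin (φ.rank + 1) → V) (a : Fˣ), Function.Injective y ∧
      (∀ i, X (y i) = a * (eps F ^ i.val * φ.toFun (i.removeNth y))) ∧
      ∀ e, e ∉ Set.range y → X e = 0 := by
  obtain ⟨C, y, a, hC, -, hB, hCB, h1, h2⟩ := hX
  exact ⟨y, a, injective_of_isBase_tail hC hB hCB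
    (injective_of_ncard_range (φ.ncard_isBase hB)), h1, h2⟩

/-- Up to a factor, the involution of an `F`-cocircuit is given by `f ↦ φ(f, z_1,…,z_q)`. -/
theorem exists_of_mem_cocircuits {n q : ℕ} (τ : Involution F) (φ : GPFun F (Fin n))
    (hq : φ.rank = q + 1) {D : Fin n → F} (hD : D ∈ φ.cocircuits τ) :
    ∃ (z : Fin q → Fin n) (b : F), ∀ f,
      τ.toFun (D f) = b * φ.toFun ((Fin.cons f z : Fin (q + 1) → Fin n) ∘ Fin.cast hq) := by
  obtain ⟨C, y, a, hC, -, hB, hCB, h1, h2⟩ := hD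
  have hr := φ.rank_le
  have hcard : (Set.range (Fin.tail y)).ncard = n - φ.rank := by
    have h3 := hB.compl_isBase_dual
    rw [Matroid.dual_dual] at h3
    have h4 := φ.ncard_isBase h3
    rw [Matroid.dual_ground, φ.matroid_ground, ← Set.compl_eq_univ_sdiff] at h4
    have h5 := Set.ncard_add_ncard_compl (Set.range (Fin.tail y))
    rw [Nat.card_fin] at h5
    omega
  have hy := injective_of_isBase_tail hC hB hCB (injective_of_ncard_range hcard)
  have hle : n - φ.rank + 1 ≤ n := by omega
  -- Complete `y`, which has $n-r+1$ entries, to an ordering of the whole ground set; the $q=r-1$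
  -- entries left over are the tuple `z`.
  obtain ⟨ρ, hρ⟩ := Equiv.Perm.exists_extending_pair (Fin.castLE hle) y
    (Fin.castLE_injective hle) hy
  obtain ⟨n', rfl⟩ : ∃ n', n = n' + 1 := ⟨n - 1, by omega⟩
  let z : Fin q → Fin (n' + 1) := fun j => ρ ⟨n' + 1 - φ.rank + 1 + j, by omega⟩
  let m : Fin (n' + 1) := ⟨n' + 1 - φ.rank, by omega⟩
  refine ⟨z, τ.toFun a * (permSign F ρ * eps F ^ m.val), fun f => ?_⟩
  by_cases hf : f ∈ Set.range y
  · obtain ⟨i, rfl⟩ := hf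
    let i' : Fin (n' + 1) := Fin.castLE hle i
    have hi' : i'.val ≤ m.val := Nat.lt_succ_iff.1 i.isLt
    -- The ordering $(y\setminus y_i,\,y_i,\,z)$: take $y_i$ to the front, then to position $m=n-r$.
    -- Its sign is $\mathrm{sign}(\rho)\epsilon^{i+m}$, and $\epsilon^i$ cancels against the sign in
    -- the definition of a circuit, so the factor does not depend on $i$.
    let σ : Equiv.Perm (Fin (n' + 1)) := ρ * (i'.cycleRange.symm * m.cycleRange)
    have hσ1 : ∀ j : Fin (n' + 1 - φ.rank), σ ⟨j, by omega⟩ = i.removeNth y j := by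
      intro j
      have hj : (⟨j, by omega⟩ : Fin (n' + 1)) < m := j.isLt
      have e1 : m.cycleRange ⟨j, by omega⟩ = (⟨j, by omega⟩ : Fin n').succ := by
        rw [Fin.cycleRange_of_lt hj]
        ext
        rw [Fin.val_add_one_of_lt (lt_of_lt_of_le hj (Fin.le_last _))]
        rfl
      have e2 : i'.succAbove ⟨j, by omega⟩ = Fin.castLE hle (i.succAbove j) := by
        ext
        simp only [Fin.succAbove, Fin.lt_def, i', Fin.val_castSucc, Fin.val_castLE]
        split_ifs <;> simp
      simp only [σ, Equiv.Perm.mul_apply, e1, Fin.cycleRange_symm_succ, e2, hρ]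
      rfl
    have hσ2 : (fun j : Fin φ.rank => σ ⟨n' + 1 - φ.rank + j, by omega⟩)
        = (Fin.cons (y i) z : Fin (q + 1) → Fin (n' + 1)) ∘ Fin.cast hq := by
      have : ∀ j : Fin (q + 1), σ ⟨n' + 1 - φ.rank + j, by omega⟩
          = (Fin.cons (y i) z : Fin (q + 1) → Fin (n' + 1)) j := by
        intro j
        refine Fin.cases ?_ (fun j => ?_) j
        · have e1 : m.cycleRange ⟨n' + 1 - φ.rank + (0 : Fin (q + 1)), by omega⟩ = 0 :=
            Fin.cycleRange_of_eq rfl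
          simp only [σ, Equiv.Perm.mul_apply, e1, Fin.cycleRange_symm_zero, Fin.cons_zero]
          exact hρ i
        · have hm : m < ⟨n' + 1 - φ.rank + j.succ, by omega⟩ := by
            simp only [Fin.lt_def, m, Fin.val_succ]
            omega
          have e1 := Fin.cycleRange_of_gt hm
          have e2 : i'.cycleRange.symm ⟨n' + 1 - φ.rank + j.succ, by omega⟩
              = ⟨n' + 1 - φ.rank + j.succ, by omega⟩ := by
            rw [Equiv.symm_apply_eq]
            exact (Fin.cycleRange_of_gt (lt_of_le_of_lt hi' hm)).symm
          simp only [σ, Equiv.Perm.mul_apply, e1, e2, Fin.cons_succ, z]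
          congr 1
          ext
          simp only [Fin.val_succ]
          omega
      funext j
      exact this (Fin.cast hq j)
    have hs : permSign F σ = permSign F ρ * (eps F ^ i.val * eps F ^ m.val) := by
      simp only [σ, permSign_mul, permSign_cycleRange, permSign_cycleRange_symm]
      rfl
    rw [h1, dualFun_eq τ φ σ hσ1, hσ2, hs, τ.map_mul, τ.map_mul, τ.map_mul, τ.invol,
      τ.map_mul, τ.map_mul, permSign, τ.map_epsSign]
    have hpow : ∀ k : ℕ, τ.toFun (eps F ^ k) = eps F ^ k := by
      intro k
      induction k with
      | zero => simpa using τ.map_one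
      | succ k ih => rw [pow_succ, τ.map_mul, ih, τ.map_eps]
    have hsq : eps F ^ i.val * eps F ^ i.val = 1 := by
      rw [← mul_pow, eps_mul_eps, one_pow]
    rw [hpow, hpow]
    generalize φ.toFun _ = t
    calc _ = τ.toFun a * (epsSign F (Equiv.Perm.sign ρ) * ((eps F ^ i.val * eps F ^ i.val)
          * eps F ^ m.val)) * t := by
          simp only [mul_assoc, mul_left_comm, mul_comm]
      _ = _ := by rw [hsq, one_mul]
  -- Outside `y` the cocircuit is zero, and so is the right-hand side, because `f` is then an entry
  -- of `z`.
  · rw [h2 f hf, τ.map_zero]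
    obtain ⟨k, rfl⟩ := ρ.surjective f
    have hk : n' + 1 - φ.rank + 1 ≤ k.val := by
      by_contra hlt
      exact hf ⟨⟨k, by omega⟩, (hρ _).symm⟩
    have h0 : φ.toFun ((Fin.cons (ρ k) z : Fin (q + 1) → Fin (n' + 1)) ∘ Fin.cast hq) = 0 := by
      refine φ.isGP.map_eq_zero _ (Fin.cast hq.symm 0)
        (Fin.cast hq.symm (Fin.succ ⟨k - (n' + 1 - φ.rank + 1), by omega⟩)) ?_ ?_
      · intro hh
        exact Fin.succ_ne_zero _ (Fin.cast_injective _ hh).symm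
      · simp only [Function.comp_apply, Fin.cast_cast, Fin.cast_eq_self, Fin.cons_zero,
          Fin.cons_succ, z]
        congr 1
        ext
        simp only
        omega
    rw [h0, mul_zero]

end GPFun

/-- Over a perfect tract, an `F`-vector and an `F`-covector of an `F`-matroid are orthogonal, in a
form without involution. -/
theorem Tract.IsPerfect.sumNull_mul {F : Type u} [Tract F] {τ : Involution F} (hF : IsPerfect τ)
    {n q : ℕ} (ψ : (Fin (q + 1) → Fin n) → F) (hψ : IsGrassmannPlucker ψ) {X Y : Fin n → F}
    (hX : ∀ z : Fin q → Fin n, SumNull fun i => X i * ψ (Fin.cons i z : Fin (q + 1) → Fin n))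
    (hY : ∀ y : Fin (q + 2) → Fin n,
      SumNull fun k : Fin (q + 2) => eps F ^ k.val * ψ (k.removeNth y) * Y (y k)) :
    SumNull fun i => X i * Y i := by
  -- Twisting `Y` by `τ` cancels the involution in the pairing. Only sufficiency is needed:
  -- cocircuits are multiples of twisted $\psi(\cdot,z)$, and circuits are multiples of the signed
  -- values $\epsilon^k\psi(y\setminus y_k)$.
  have h := hF n ⟨q + 1, ψ, hψ⟩ X ?_ (fun i => τ.toFun (Y i)) ?_
  · simpa only [Orthogonal, τ.invol] using h
  · intro D hD
    obtain ⟨z, b, hb⟩ := GPFun.exists_of_mem_cocircuits τ ⟨q + 1, ψ, hψ⟩ rfl hD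
    simp only [Orthogonal, hb, mul_left_comm _ b]
    exact (hX z).mul_left b
  · intro C hC
    obtain ⟨y, a, hy, h1, h2⟩ := GPFun.exists_of_mem_circuits hC
    simp only [Orthogonal, ← τ.map_mul]
    refine τ.map_sumNull ?_
    refine (SumNull.comp_injective_iff hy fun i hi => by rw [h2 i hi, mul_zero]).1 ?_
    have := (hY y).mul_left (a : F)
    simp only [h1]
    convert this using 2 with k
    simp only [mul_comm, mul_left_comm]

/-! ### Individual Plücker relations -/

section

variable {F : Type u} [Tract F] {V : Type v}

/-- The Plücker flag relation between `ν` and `μ` at given arguments `y` and `x`. -/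
def PluckerAt {w q : ℕ} (ν : (Fin w → V) → F) (μ : (Fin (q + 1) → V) → F) (y : Fin (w + 1) → V)
    (x : Fin q → V) : Prop :=
  SumNull fun k : Fin (w + 1) =>
    eps F ^ k.val * ν (k.removeNth y) * μ (Fin.cons (y k) x : Fin (q + 1) → V)

/-- The exponents $k+1$ and $k$ differ by a global factor $\epsilon$, which does not affect nullity.
-/
theorem pluckerFlagRel_succ_iff {w q : ℕ} {ν : (Fin w → V) → F} {μ : (Fin (q + 1) → V) → F} :
    PluckerFlagRel ν μ ↔ ∀ y x, PluckerAt ν μ y x := by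
  have key : ∀ y x, (SumNull fun k : Fin (w + 1) => eps F ^ (k.val + 1) * ν (k.removeNth y) *
      μ ((Fin.cons (y k) x : Fin (q + 1) → V) ∘ Fin.cast rfl)) ↔ PluckerAt ν μ y x := by
    intro y x
    refine Iff.trans ?_ (SumNull.mul_left_iff (eps_ne_zero (F := F)))
    simp only [pow_succ', mul_assoc]
    rfl
  constructor
  · intro h y x
    exact (key y x).1 (h q rfl x y)
  · rintro h q' hq x y
    obtain rfl : q = q' := by omega
    exact (key y x).2 (h y x)

theorem PluckerAt.comp_perm_left_iff {w q : ℕ} {ν : (Fin w → V) → F}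
    (hν : IsAlternatingFun ν) {μ : (Fin (q + 1) → V) → F} {y : Fin (w + 1) → V}
    {x : Fin q → V} (σ : Equiv.Perm (Fin (w + 1))) :
    PluckerAt ν μ (y ∘ σ) x ↔ PluckerAt ν μ y x := by
  simp only [PluckerAt, hν.removeNth_comp_perm, Function.comp_apply, mul_assoc]
  rw [SumNull.mul_left_iff (permSign_ne_zero σ)]
  exact SumNull.comp_equiv_iff σ (a := fun k =>
    eps F ^ k.val * (ν (k.removeNth y) * μ (Fin.cons (y k) x : Fin (q + 1) → V)))

theorem IsAlternatingFun.cons_comp_perm {n : ℕ} {φ : (Fin (n + 1) → V) → F}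
    (h : IsAlternatingFun φ) (a : V) (x : Fin n → V) (σ : Equiv.Perm (Fin n)) :
    φ (Fin.cons a (x ∘ σ) : Fin (n + 1) → V)
      = permSign F σ * φ (Fin.cons a x : Fin (n + 1) → V) := by
  have h1 : (Fin.cons a (x ∘ σ) : Fin (n + 1) → V)
      = (Fin.cons a x : Fin (n + 1) → V) ∘ Equiv.Perm.decomposeFin.symm (0, σ) := by
    funext i
    refine Fin.cases ?_ (fun i => ?_) i
    · simp
    · simp [Equiv.Perm.decomposeFin_symm_apply_succ]
  rw [h1, h.comp_perm, permSign, Equiv.Perm.decomposeFin.symm_sign]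
  simp [permSign]

theorem PluckerAt.comp_perm_right_iff {w q : ℕ} {ν : (Fin w → V) → F}
    {μ : (Fin (q + 1) → V) → F} (hμ : IsAlternatingFun μ) {y : Fin (w + 1) → V}
    {x : Fin q → V} (σ : Equiv.Perm (Fin q)) :
    PluckerAt ν μ y (x ∘ σ) ↔ PluckerAt ν μ y x := by
  simp only [PluckerAt, hμ.cons_comp_perm, mul_left_comm _ (permSign F σ)]
  rw [SumNull.mul_left_iff (permSign_ne_zero σ)]

/-- If `x` has a repeated entry, all terms vanish. Otherwise reorder `y` as $(p,s,x)$: only the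
terms that move $p$ or $s$ survive, and they have the form $t$ and $\epsilon t$. -/
theorem IsAlternatingFun.pluckerAt_of_range_subset {q : ℕ} {φ : (Fin (q + 1) → V) → F}
    (h : IsAlternatingFun φ) {y : Fin (q + 2) → V} {x : Fin q → V}
    (hxy : Set.range x ⊆ Set.range y) : PluckerAt φ φ y x := by
  by_cases hx : Function.Injective x
  · choose g hg using fun i => hxy (Set.mem_range_self i)
    have hgi : Function.Injective g := fun i j hij => hx (by rw [← hg, ← hg, hij])
    obtain ⟨σ, hσ⟩ := Equiv.Perm.exists_extending_pair (fun i : Fin q => i.succ.succ) g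
      (fun i j hij => Fin.succ_injective _ (Fin.succ_injective _ hij)) hgi
    rw [← PluckerAt.comp_perm_left_iff h σ]
    obtain ⟨p, s, hps⟩ : ∃ p s, y ∘ σ
        = (Fin.cons p (Fin.cons s x : Fin (q + 1) → V) : Fin (q + 2) → V) := by
      refine ⟨y (σ 0), y (σ 1), ?_⟩
      funext i
      refine Fin.cases ?_ (fun i => Fin.cases ?_ (fun i => ?_) i) i
      · simp
      · simp
      · simp [hσ, hg]
    rw [hps, PluckerAt, SumNull, Fin.sum_univ_succ, Fin.sum_univ_succ, Finset.sum_eq_zero, add_zero]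
    · have h0 : (0 : Fin (q + 2)).removeNth
          (Fin.cons p (Fin.cons s x : Fin (q + 1) → V) : Fin (q + 2) → V) = Fin.cons s x := by
        funext i
        simp [Fin.removeNth]
      have h1 : (Fin.succ 0 : Fin (q + 2)).removeNth
          (Fin.cons p (Fin.cons s x : Fin (q + 1) → V) : Fin (q + 2) → V) = Fin.cons p x := by
        funext i
        refine Fin.cases ?_ (fun i => ?_) i
        · simp [Fin.removeNth]
        · simp [Fin.removeNth]
      rw [h0, h1]
      have := term_add_eps_mul_mem (φ (Fin.cons s x : Fin (q + 1) → V)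
        * φ (Fin.cons p x : Fin (q + 1) → V))
      simpa [mul_assoc, mul_comm (φ (Fin.cons p x : Fin (q + 1) → V))] using this
    · intro i _
      rw [Fin.cons_succ, Fin.cons_succ, h.cons_self ⟨i, rfl⟩, mul_zero, term_zero]
  · refine SumNull.of_forall_eq_zero fun k => ?_
    rw [h.eq_zero_of_not_injective (x := Fin.cons (y k) x), mul_zero]
    intro hh
    exact hx (Fin.cons_injective_iff.1 hh).2

/-! ### From three-term relations to all Plücker relations -/

/-- The formal sum `a - b + c` belongs to the nullset. -/
def ThreeNull (a b c : F) : Prop :=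
  term a + term (eps F * b) + term c ∈ (nullset : Set (MonoidAlgebra ℕ Fˣ))

theorem sumNull_fin_three_iff {f : Fin 3 → F} {a b c : F} (ha : f 0 = a) (hb : f 1 = eps F * b)
    (hc : f 2 = c) : SumNull f ↔ ThreeNull a b c := by
  rw [SumNull, Fin.sum_univ_three, ha, hb, hc, ThreeNull]

namespace IsAlternatingFun

/-- The three-term relations imply the Plücker relations for the function
`(a, b) ↦ φ(a, b, x_1,…,x_m)`. -/
theorem isGrassmannPlucker_cons_cons {S : Type w} {m : ℕ} {φ : (Fin (m + 2) → V) → F}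
    (h : IsAlternatingFun φ) (f : S → V) (A : Fin m → V)
    (h3 : ∀ a b c d : V, ThreeNull
      (φ (Fin.cons b (Fin.cons c A : Fin (m + 1) → V) : Fin (m + 2) → V)
        * φ (Fin.cons a (Fin.cons d A : Fin (m + 1) → V) : Fin (m + 2) → V))
      (φ (Fin.cons a (Fin.cons c A : Fin (m + 1) → V) : Fin (m + 2) → V)
        * φ (Fin.cons b (Fin.cons d A : Fin (m + 1) → V) : Fin (m + 2) → V))
      (φ (Fin.cons a (Fin.cons b A : Fin (m + 1) → V) : Fin (m + 2) → V)
        * φ (Fin.cons c (Fin.cons d A : Fin (m + 1) → V) : Fin (m + 2) → V)))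
    (hne : ∃ a b, φ (Fin.cons (f a) (Fin.cons (f b) A : Fin (m + 1) → V) : Fin (m + 2) → V) ≠ 0) :
    IsGrassmannPlucker fun t : Fin 2 → S =>
      φ (Fin.cons (f (t 0)) (Fin.cons (f (t 1)) A : Fin (m + 1) → V) : Fin (m + 2) → V) where
  exists_ne_zero := by
    obtain ⟨a, b, hab⟩ := hne
    exact ⟨![a, b], hab⟩
  map_swap := by
    have h01 : ∀ t : Fin 2 → S,
        φ (Fin.cons (f (t 1)) (Fin.cons (f (t 0)) A : Fin (m + 1) → V) : Fin (m + 2) → V)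
        = eps F * φ (Fin.cons (f (t 0)) (Fin.cons (f (t 1)) A : Fin (m + 1) → V)) :=
      fun t => h.swap_cons_cons _ _ _
    intro t i j hij
    fin_cases i <;> fin_cases j
    · exact absurd rfl hij
    · simpa using h01 t
    · simpa using h01 t
    · exact absurd rfl hij
  map_eq_zero := by
    have h01 : ∀ t : Fin 2 → S, t 0 = t 1 →
        φ (Fin.cons (f (t 0)) (Fin.cons (f (t 1)) A : Fin (m + 1) → V) : Fin (m + 2) → V) = 0 :=
      fun t ht => h.cons_self ⟨0, by simp [ht]⟩
    intro t i j hij ht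
    fin_cases i <;> fin_cases j
    · exact absurd rfl hij
    · exact h01 t ht
    · exact h01 t ht.symm
    · exact absurd rfl hij
  plucker := by
    rw [pluckerFlagRel_succ_iff]
    intro y x
    refine (sumNull_fin_three_iff ?_ ?_ ?_).2 (h3 (f (y 0)) (f (y 1)) (f (y 2)) (f (x 0)))
    · simp [Fin.removeNth]
    · simp [Fin.removeNth, mul_assoc]
    · simp [Fin.removeNth, pow_two, eps_mul_eps]
      exact Or.inl rfl

open Classical in
/-- The number of entries of `x` that are not entries of `y`. -/
noncomputable def numOutside {k l : ℕ} (x : Fin k → V) (y : Fin l → V) : ℕ :=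
  ∑ i, if x i ∈ Set.range y then 0 else 1

theorem numOutside_comp_perm {k l : ℕ} (x : Fin k → V) (y : Fin l → V)
    (σ : Equiv.Perm (Fin k)) : numOutside (x ∘ σ) y = numOutside x y := by
  classical
  exact Equiv.sum_comp σ fun i => if x i ∈ Set.range y then 0 else 1

theorem numOutside_cons_lt {k l : ℕ} {a b : V} {x : Fin k → V} {y : Fin l → V}
    (ha : a ∈ Set.range y) (hb : b ∉ Set.range y) :
    numOutside (Fin.cons a x : Fin (k + 1) → V) y
      < numOutside (Fin.cons b x : Fin (k + 1) → V) y := by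
  classical
  simp only [numOutside, Fin.sum_univ_succ]
  change (if a ∈ Set.range y then 0 else 1) + (∑ i, if x i ∈ Set.range y then 0 else 1)
    < (if b ∈ Set.range y then 0 else 1) + (∑ i, if x i ∈ Set.range y then 0 else 1)
  rw [if_pos ha, if_neg hb]
  omega

/-- Over a perfect tract, the three-term relations together with the exchange property imply all
Plücker relations. -/
theorem pluckerAt_of_threeNull {τ : Involution F} (hF : IsPerfect τ) {m : ℕ}
    {φ : (Fin (m + 2) → V) → F} (h : IsAlternatingFun φ)
    (hexch : ∀ (y : Fin (m + 3) → V) (k : Fin (m + 3)) (a : V) (A : Fin m → V),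
      φ (k.removeNth y) ≠ 0 →
      φ (Fin.cons (y k) (Fin.cons a A : Fin (m + 1) → V) : Fin (m + 2) → V) ≠ 0 →
      a ∉ Set.range y →
      ∃ b, φ (Fin.cons (y k) (Fin.cons (y b) A : Fin (m + 1) → V) : Fin (m + 2) → V) ≠ 0)
    (h3 : ∀ (A : Fin m → V) (a b c d : V), ThreeNull
      (φ (Fin.cons b (Fin.cons c A : Fin (m + 1) → V) : Fin (m + 2) → V)
        * φ (Fin.cons a (Fin.cons d A : Fin (m + 1) → V) : Fin (m + 2) → V))
      (φ (Fin.cons a (Fin.cons c A : Fin (m + 1) → V) : Fin (m + 2) → V)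
        * φ (Fin.cons b (Fin.cons d A : Fin (m + 1) → V) : Fin (m + 2) → V))
      (φ (Fin.cons a (Fin.cons b A : Fin (m + 1) → V) : Fin (m + 2) → V)
        * φ (Fin.cons c (Fin.cons d A : Fin (m + 1) → V) : Fin (m + 2) → V)))
    (y : Fin (m + 3) → V) (x : Fin (m + 1) → V) : PluckerAt φ φ y x := by
  -- The induction keeps `y` fixed and replaces entries of `x` outside `y` by entries of `y`. The
  -- base case is `pluckerAt_of_range_subset`.
  induction hN : numOutside x y using Nat.strong_induction_on generalizing x with
  | _ N ih =>
  by_cases hxy : Set.range x ⊆ Set.range y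
  · exact h.pluckerAt_of_range_subset hxy
  obtain ⟨_, ⟨i, rfl⟩, hi⟩ := Set.not_subset.1 hxy
  rw [← PluckerAt.comp_perm_right_iff h i.cycleRange.symm, Fin.comp_cycleRange_symm]
  rw [← numOutside_comp_perm x y i.cycleRange.symm, Fin.comp_cycleRange_symm] at hN
  generalize x i = a at hi hN ⊢
  generalize i.removeNth x = A at hN ⊢
  by_cases hne : ∃ i j,
      φ (Fin.cons (y i) (Fin.cons (y j) A : Fin (m + 1) → V) : Fin (m + 2) → V) ≠ 0
  -- Perfection is applied on the index set of `y`, to $\psi(i,j)=\varphi(y_i,y_j,A)$,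
  -- $X_i=\epsilon^i\varphi(y\setminus y_i)$ and $Y_i=\varphi(y_i,a,A)$. The condition on $X$ is the
  -- Plücker relation with `a` replaced by an entry of `y`, known by induction; the condition on $Y$
  -- is a three-term relation.
  · refine hF.sumNull_mul _ (h.isGrassmannPlucker_cons_cons y A (h3 A) hne) (fun z => ?_)
      (fun j => ?_)
    · refine ih _ ?_ (Fin.cons (y (z 0)) A) rfl
      rw [← hN]
      exact numOutside_cons_lt ⟨_, rfl⟩ hi
    · refine (sumNull_fin_three_iff ?_ ?_ ?_).2 (h3 A (y (j 0)) (y (j 1)) (y (j 2)) a)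
      · simp [Fin.removeNth]
      · simp [Fin.removeNth, mul_assoc]
      · simp [Fin.removeNth, pow_two, eps_mul_eps]
        exact Or.inl rfl
  -- Here $\psi=0$ and perfection does not apply. A nonzero term would let `a` be exchanged for an
  -- entry of `y`, which makes $\psi$ nonzero.
  · refine SumNull.of_forall_eq_zero fun k => ?_
    by_contra hk
    obtain ⟨b, hb⟩ := hexch y k a A (right_ne_zero_of_mul (left_ne_zero_of_mul hk))
      (right_ne_zero_of_mul hk) hi
    exact hne ⟨_, _, hb⟩

end IsAlternatingFun

/-! ### Exchange properties from the flag relations -/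

theorem Set.range_cons_removeNth {n : ℕ} {x : Fin (n + 1) → V} (hx : Function.Injective x)
    (i : Fin (n + 1)) (b : V) :
    Set.range (Fin.cons b (i.removeNth x) : Fin (n + 1) → V)
      = insert b (Set.range x \ {x i}) := by
  rw [Fin.range_cons]
  congr 1
  ext c
  simp only [Set.mem_range, Fin.removeNth, Set.mem_sdiff, Set.mem_singleton_iff]
  constructor
  · rintro ⟨k, rfl⟩
    exact ⟨⟨_, rfl⟩, fun hh => Fin.succAbove_ne i k (hx hh)⟩
  · rintro ⟨⟨k, rfl⟩, hk⟩
    obtain ⟨l, rfl⟩ := Fin.exists_succAbove_eq (x := k) (y := i) (fun hh => hk (by rw [hh]))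
    exact ⟨l, rfl⟩

theorem Fin.removeNth_succ_cons {n : ℕ} (h : V) (v : Fin (n + 1) → V) (t : Fin (n + 1)) :
    (t.succ.removeNth (Fin.cons h v : Fin (n + 2) → V) : Fin (n + 1) → V)
      = Fin.cons h (t.removeNth v) := by
  funext i
  refine Fin.cases ?_ (fun i => ?_) i
  · simp [Fin.removeNth]
  · simp [Fin.removeNth]

/-- The sets of arguments on which a function does not vanish. -/
def supportSets {n : ℕ} (φ : (Fin n → V) → F) : Set (Set V) :=
  {B | ∃ x, φ x ≠ 0 ∧ Set.range x = B}

theorem IsAlternatingFun.ncard_of_mem {n : ℕ} {φ : (Fin n → V) → F} (h : IsAlternatingFun φ)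
    {B : Set V} (hB : B ∈ supportSets φ) : B.ncard = n := by
  obtain ⟨x, hx, rfl⟩ := hB
  rw [← Set.image_univ, Set.ncard_image_of_injective _ (h.injective hx), Set.ncard_univ,
    Nat.card_fin]

theorem finite_of_mem_supportSets {n : ℕ} {φ : (Fin n → V) → F} {B : Set V}
    (hB : B ∈ supportSets φ) : B.Finite := by
  obtain ⟨x, _, rfl⟩ := hB
  exact Set.finite_range x

/-- In the flag relation for $y=(a,B)$ and $x=D\setminus a$, the term that moves $a$ is nonzero.
Another term must therefore be nonzero, and the element $b$ that it moves gives both exchanges at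
once. -/
theorem PluckerFlagRel.exists_exchange {w r : ℕ} {ν : (Fin w → V) → F} {μ : (Fin r → V) → F}
    (hν : IsAlternatingFun ν) (hμ : IsAlternatingFun μ) (h : PluckerFlagRel ν μ) {B D : Set V}
    (hB : B ∈ supportSets ν) (hD : D ∈ supportSets μ) {a : V} (ha : a ∈ D \ B) :
    ∃ b ∈ B \ D, insert b (D \ {a}) ∈ supportSets μ ∧ insert a (B \ {b}) ∈ supportSets ν := by
  obtain ⟨v, hv, rfl⟩ := hB
  obtain ⟨u, hu, rfl⟩ := hD
  obtain ⟨⟨i, rfl⟩, haB⟩ := ha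
  obtain ⟨q, rfl⟩ : ∃ q, r = q + 1 := ⟨r - 1, by have := i.isLt; omega⟩
  have hui := hμ.injective hu
  have hvi := hν.injective hv
  have h1 := (pluckerFlagRel_succ_iff.1 h) (Fin.cons (u i) v) (i.removeNth u)
  have h0 : (0 : Fin (w + 1)).removeNth (Fin.cons (u i) v : Fin (w + 1) → V) = v := by
    funext k; simp [Fin.removeNth]
  obtain ⟨j, hj0, hj⟩ := SumNull.exists_ne_zero h1 (i := 0) (by
    rw [h0, Fin.cons_zero, hμ.cons_removeNth]
    exact mul_ne_zero (mul_ne_zero (pow_ne_zero _ eps_ne_zero) hv)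
      (mul_ne_zero (pow_ne_zero _ eps_ne_zero) hu))
  obtain ⟨t, rfl⟩ := Fin.exists_succ_eq.2 hj0
  obtain ⟨w, rfl⟩ : ∃ w', w = w' + 1 := ⟨w - 1, by have := t.isLt; omega⟩
  rw [Fin.cons_succ, Fin.removeNth_succ_cons] at hj
  have hj1 := right_ne_zero_of_mul hj
  have hj2 := right_ne_zero_of_mul (left_ne_zero_of_mul hj)
  refine ⟨v t, ⟨⟨t, rfl⟩, ?_⟩, ⟨_, hj1, Set.range_cons_removeNth hui _ _⟩,
    ⟨_, hj2, Set.range_cons_removeNth hvi _ _⟩⟩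
  rintro ⟨k, hk⟩
  have hki : k ≠ i := by
    rintro rfl
    exact haB ⟨t, hk.symm⟩
  obtain ⟨l, rfl⟩ := Fin.exists_succAbove_eq hki
  exact (Fin.cons_injective_iff.1 (hμ.injective hj1)).1 ⟨l, hk⟩

namespace PluckerFlagRel

variable {r : ℕ} {ν : (Fin (r + 1) → V) → F} {μ : (Fin r → V) → F}

/-- Suppose that both alternatives fail, and move $D$ towards $B$ by symmetric exchanges. The
element $b$ that enters $D$ is never $a$, since otherwise $B-a+c$ would realise the second
alternative. In the end $D\subseteq B\setminus a$, and cardinalities force equality. -/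
theorem sdiff_singleton_mem_or (hν : IsAlternatingFun ν) (hμ : IsAlternatingFun μ)
    (h : PluckerFlagRel ν μ) {B D : Set V} (hB : B ∈ supportSets ν) (hD : D ∈ supportSets μ)
    {a : V} (ha : a ∈ B \ D) :
    B \ {a} ∈ supportSets μ ∨ ∃ b ∈ D \ B, insert b (B \ {a}) ∈ supportSets ν := by
  by_contra! hno
  obtain ⟨hno1, hno2⟩ := hno
  induction hN : (D \ B).ncard using Nat.strong_induction_on generalizing D with
  | _ N ih =>
  have hDf := finite_of_mem_supportSets hD
  have hBf := finite_of_mem_supportSets hB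
  rcases (D \ B).eq_empty_or_nonempty with h0 | ⟨c, hc⟩
  · have hsub : D ⊆ B \ {a} :=
      fun e he => ⟨Set.sdiff_eq_empty.1 h0 he, fun hea => ha.2 (by rwa [← hea])⟩
    have h1 : (B \ {a}).ncard ≤ D.ncard := by
      rw [Set.ncard_sdiff_singleton_of_mem ha.1, hν.ncard_of_mem hB, hμ.ncard_of_mem hD]
      rfl
    exact hno1 (Set.eq_of_subset_of_ncard_le hsub h1 (hBf.sdiff) ▸ hD)
  · obtain ⟨b, hb, h1, h2⟩ := h.exists_exchange hν hμ hB hD hc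
    have hba : b ≠ a := by
      rintro rfl
      exact hno2 c hc h2
    have hsub : insert b (D \ {c}) \ B ⊂ D \ B := by
      refine ⟨?_, fun hh => (hh hc).1.elim (fun h3 => hc.2 (h3 ▸ hb.1)) fun h3 => h3.2 rfl⟩
      rintro e ⟨rfl | he, heB⟩
      · exact absurd hb.1 heB
      · exact ⟨he.1, heB⟩
    refine ih _ (hN ▸ Set.ncard_lt_ncard hsub hDf.sdiff) h1 ⟨ha.1, ?_⟩
      (fun e he => hno2 e (hsub.1 he)) rfl
    rintro (h3 | h3)
    · exact hba h3.symm
    · exact ha.2 h3.1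

/-- Now symmetric exchanges move $B$ towards $D$. Once $D\subseteq B$, the two sets differ by one
element. The elements that enter $B$ lie in $D$, so the final $b$ belongs to the original $B$. -/
theorem exists_insert_mem (hν : IsAlternatingFun ν) (hμ : IsAlternatingFun μ)
    (h : PluckerFlagRel ν μ) {B D : Set V} (hB : B ∈ supportSets ν) (hD : D ∈ supportSets μ) :
    ∃ b ∈ B \ D, insert b D ∈ supportSets ν := by
  induction hN : (D \ B).ncard using Nat.strong_induction_on generalizing B with
  | _ N ih =>
  have hDf := finite_of_mem_supportSets hD
  have hBf := finite_of_mem_supportSets hB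
  rcases (D \ B).eq_empty_or_nonempty with h0 | ⟨c, hc⟩
  · have hsub : D ⊆ B := Set.sdiff_eq_empty.1 h0
    obtain ⟨b, hb⟩ := Set.exists_mem_notMem_of_ncard_lt_ncard (s := D) (t := B) (by
      rw [hν.ncard_of_mem hB, hμ.ncard_of_mem hD]
      exact Nat.lt_succ_self _) hDf
    refine ⟨b, hb, ?_⟩
    have h1 : insert b D = B := by
      refine Set.eq_of_subset_of_ncard_le (Set.insert_subset hb.1 hsub) ?_ hBf
      rw [Set.ncard_insert_of_notMem hb.2 hDf, hν.ncard_of_mem hB, hμ.ncard_of_mem hD]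
    rwa [h1]
  · obtain ⟨b, hb, h1, h2⟩ := h.exists_exchange hν hμ hB hD hc
    have hsub : D \ insert c (B \ {b}) ⊂ D \ B := by
      refine ⟨fun e he => ⟨he.1, fun heB => he.2 (Or.inr ⟨heB, ?_⟩)⟩, fun hh =>
        (hh hc).2 (Or.inl rfl)⟩
      rintro rfl
      exact hb.2 he.1
    obtain ⟨e, he, heD⟩ := ih _ (hN ▸ Set.ncard_lt_ncard hsub hDf.sdiff) h2 rfl
    refine ⟨e, ⟨?_, he.2⟩, heD⟩
    rcases he.1 with rfl | h3
    · exact absurd hc.1 he.2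
    · exact h3.1

end PluckerFlagRel

/-! ### Gluing two functions along a new element -/

theorem exists_eq_some_comp {n : ℕ} {x : Fin n → Option V} (h : ∀ i, x i ≠ none) :
    ∃ u : Fin n → V, x = some ∘ u := by
  choose u hu using fun i => Option.ne_none_iff_exists'.1 (h i)
  exact ⟨u, funext hu⟩

namespace IsAlternatingFun

open Classical in
/-- The extension by zero of a function on `V^n` to `(V ⊔ {e})^n`. -/
noncomputable def extendOption {n : ℕ} (ν : (Fin n → V) → F) (x : Fin n → Option V) : F :=
  if h : ∃ u : Fin n → V, x = some ∘ u then ν h.choose else 0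

theorem extendOption_some {n : ℕ} (ν : (Fin n → V) → F) (u : Fin n → V) :
    extendOption ν (some ∘ u) = ν u := by
  have h : ∃ u' : Fin n → V, some ∘ u = some ∘ u' := ⟨u, rfl⟩
  rw [extendOption, dif_pos h]
  congr 1
  exact ((Option.some_injective V).comp_left h.choose_spec).symm

theorem extendOption_eq_zero {n : ℕ} (ν : (Fin n → V) → F) {x : Fin n → Option V} {i : Fin n}
    (hi : x i = none) : extendOption ν x = 0 := by
  rw [extendOption, dif_neg]
  rintro ⟨u, rfl⟩
  exact Option.some_ne_none _ hi

theorem extendOption_isAlternatingFun {n : ℕ} {ν : (Fin n → V) → F} (h : IsAlternatingFun ν) :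
    IsAlternatingFun (extendOption ν) where
  map_swap x i j hij := by
    by_cases hx : ∀ k, x k ≠ none
    · obtain ⟨u, rfl⟩ := exists_eq_some_comp hx
      rw [Function.comp_assoc, extendOption_some, extendOption_some, h.map_swap _ _ _ hij]
    · push Not at hx
      obtain ⟨k, hk⟩ := hx
      rw [extendOption_eq_zero ν hk, extendOption_eq_zero ν (i := Equiv.swap i j k) (by simpa),
        mul_zero]
  map_eq_zero x i j hij hx := by
    by_cases hn : ∀ k, x k ≠ none
    · obtain ⟨u, rfl⟩ := exists_eq_some_comp hn
      rw [extendOption_some, h.map_eq_zero u i j hij (Option.some_injective V hx)]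
    · push Not at hn
      exact extendOption_eq_zero ν hn.choose_spec

open Classical in
/-- The alternating function `φ` on `V ⊔ {e}` with `φ(x) = ν(x)` and `φ(e, x) = μ(x)` for arguments
in `V`. -/
noncomputable def glue {r : ℕ} (μ : (Fin r → V) → F) (ν : (Fin (r + 1) → V) → F)
    (x : Fin (r + 1) → Option V) : F :=
  if h : ∃ σ : Equiv.Perm (Fin (r + 1)), x (σ 0) = none then
    permSign F h.choose * extendOption μ (Fin.tail (x ∘ h.choose))
  else extendOption ν x

variable {r : ℕ} {μ : (Fin r → V) → F} {ν : (Fin (r + 1) → V) → F}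

/-- Independence of the chosen permutation. Choices that bring the same position to the front agree
by alternation; if two positions carry the new element, one copy stays in the tail for either choice
and both values are zero. -/
theorem glue_of_eq_none (hμ : IsAlternatingFun μ) {x : Fin (r + 1) → Option V}
    {σ : Equiv.Perm (Fin (r + 1))} (hσ : x (σ 0) = none) :
    glue μ ν x = permSign F σ * extendOption μ (Fin.tail (x ∘ σ)) := by
  have h : ∃ σ : Equiv.Perm (Fin (r + 1)), x (σ 0) = none := ⟨σ, hσ⟩
  have key : ∀ σ ρ : Equiv.Perm (Fin (r + 1)), x (ρ 0) = none → σ 0 ≠ ρ 0 →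
      extendOption μ (Fin.tail (x ∘ σ)) = 0 := by
    intro σ ρ hρ hne
    have h0 : σ.symm (ρ 0) ≠ 0 := fun hh => hne (σ.symm_apply_eq.1 hh).symm
    obtain ⟨j, hj⟩ := Fin.exists_succ_eq.2 h0
    exact extendOption_eq_zero μ (i := j) (by simp [Fin.tail, hj, hρ])
  rw [glue, dif_pos h]
  by_cases h0 : h.choose 0 = σ 0
  · exact hμ.extendOption_isAlternatingFun.permSign_mul_tail x h0
  · rw [key _ σ hσ h0, key σ _ h.choose_spec (Ne.symm h0), mul_zero, mul_zero]

theorem glue_of_forall_ne_none {x : Fin (r + 1) → Option V} (hx : ∀ i, x i ≠ none) :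
    glue μ ν x = extendOption ν x := by
  rw [glue, dif_neg]
  rintro ⟨σ, hσ⟩
  exact hx _ hσ

theorem glue_some (u : Fin (r + 1) → V) : glue μ ν (some ∘ u) = ν u := by
  rw [glue_of_forall_ne_none (x := some ∘ u) fun i => Option.some_ne_none _, extendOption_some]

theorem glue_none (hμ : IsAlternatingFun μ) (u : Fin r → V) :
    glue μ ν (Fin.cons none (some ∘ u) : Fin (r + 1) → Option V) = μ u := by
  rw [glue_of_eq_none hμ (σ := 1) (by simp)]
  simp [permSign, extendOption_some]

theorem glue_isAlternatingFun (hμ : IsAlternatingFun μ) (hν : IsAlternatingFun ν) :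
    IsAlternatingFun (glue μ ν) where
  map_swap x i j hij := by
    by_cases hx : ∀ k, x k ≠ none
    · rw [glue_of_forall_ne_none hx, glue_of_forall_ne_none (x := x ∘ Equiv.swap i j) fun k => hx _,
        hν.extendOption_isAlternatingFun.map_swap _ _ _ hij]
    · push Not at hx
      obtain ⟨k, hk⟩ := hx
      have h1 : x (k.cycleRange.symm 0) = none := by simpa
      have h2 : (x ∘ Equiv.swap i j) ((Equiv.swap i j * k.cycleRange.symm) 0) = none := by
        simpa
      rw [glue_of_eq_none hμ h1, glue_of_eq_none hμ h2, permSign_mul, permSign,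
        Equiv.Perm.sign_swap hij, epsSign_neg_one, mul_assoc]
      have h3 : (x ∘ Equiv.swap i j) ∘ (Equiv.swap i j * k.cycleRange.symm)
          = x ∘ k.cycleRange.symm := by
        funext l
        simp
      rw [h3]
  map_eq_zero x i j hij hxx := by
    by_cases hx : ∀ k, x k ≠ none
    · rw [glue_of_forall_ne_none hx, hν.extendOption_isAlternatingFun.map_eq_zero x i j hij hxx]
    · push Not at hx
      obtain ⟨k, hk⟩ := hx
      rw [glue_of_eq_none hμ (σ := k.cycleRange.symm) (by simpa), Fin.comp_cycleRange_symm,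
        Fin.tail_cons, mul_eq_zero]
      right
      by_cases hik : i = k
      · obtain ⟨l, rfl⟩ := Fin.exists_succAbove_eq (x := j) (y := k) (by rintro rfl; exact hij hik)
        exact extendOption_eq_zero μ (i := l) (by rw [Fin.removeNth, ← hxx, hik, hk])
      · by_cases hjk : j = k
        · obtain ⟨l, rfl⟩ := Fin.exists_succAbove_eq hik
          exact extendOption_eq_zero μ (i := l) (by rw [Fin.removeNth, hxx, hjk, hk])
        · obtain ⟨l, rfl⟩ := Fin.exists_succAbove_eq hik
          obtain ⟨l', rfl⟩ := Fin.exists_succAbove_eq hjk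
          exact hμ.extendOption_isAlternatingFun.map_eq_zero _ l l'
            (fun hh => hij (by rw [hh])) hxx

/-- An alternating function on `V ⊔ {e}` is determined by its values on tuples in which `e` does
not occur, or occurs only in the first place. -/
theorem ext_option {φ ψ : (Fin (r + 1) → Option V) → F} (hφ : IsAlternatingFun φ)
    (hψ : IsAlternatingFun ψ) (h1 : ∀ u : Fin (r + 1) → V, φ (some ∘ u) = ψ (some ∘ u))
    (h2 : ∀ u : Fin r → V, φ (Fin.cons none (some ∘ u) : Fin (r + 1) → Option V)
      = ψ (Fin.cons none (some ∘ u) : Fin (r + 1) → Option V)) : φ = ψ := by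
  funext x
  by_cases hx : ∀ k, x k ≠ none
  · obtain ⟨u, rfl⟩ := exists_eq_some_comp hx
    exact h1 u
  · push Not at hx
    obtain ⟨k, hk⟩ := hx
    have e1 := hφ.cons_removeNth x k
    have e2 := hψ.cons_removeNth x k
    rw [hk] at e1 e2
    refine mul_left_cancel₀ (pow_ne_zero k.val (eps_ne_zero (F := F))) ?_
    rw [← e1, ← e2]
    by_cases hr : ∀ l, k.removeNth x l ≠ none
    · obtain ⟨u, hu⟩ := exists_eq_some_comp hr
      rw [hu]
      exact h2 u
    · push Not at hr
      obtain ⟨l, hl⟩ := hr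
      rw [hφ.cons_self ⟨l, hl⟩, hψ.cons_self ⟨l, hl⟩]

theorem mem_supportSets_glue_iff (hμ : IsAlternatingFun μ) (hν : IsAlternatingFun ν)
    {B : Set (Option V)} : B ∈ supportSets (glue μ ν) ↔
      (∃ C ∈ supportSets ν, B = some '' C) ∨ ∃ D ∈ supportSets μ, B = insert none (some '' D) := by
  have hφ := glue_isAlternatingFun hμ hν
  constructor
  · rintro ⟨x, hx, rfl⟩
    by_cases hn : ∀ k, x k ≠ none
    · obtain ⟨u, rfl⟩ := exists_eq_some_comp hn
      rw [glue_some] at hx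
      exact Or.inl ⟨_, ⟨u, hx, rfl⟩, Set.range_comp _ _⟩
    · push Not at hn
      obtain ⟨k, hk⟩ := hn
      have e1 := hφ.cons_removeNth x k
      rw [hk] at e1
      have hne := mul_ne_zero (pow_ne_zero k.val (eps_ne_zero (F := F))) hx
      rw [← e1] at hne
      have hr : ∀ l, k.removeNth x l ≠ none := fun l hl => hne (hφ.cons_self ⟨l, hl⟩)
      obtain ⟨u, hu⟩ := exists_eq_some_comp hr
      rw [hu, glue_none hμ] at hne
      refine Or.inr ⟨_, ⟨u, hne, rfl⟩, ?_⟩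
      rw [← Set.range_comp, ← hu, ← Fin.range_cons, ← hk, ← Fin.comp_cycleRange_symm,
        k.cycleRange.symm.surjective.range_comp]
  · rintro (⟨_, ⟨u, hu, rfl⟩, rfl⟩ | ⟨_, ⟨u, hu, rfl⟩, rfl⟩)
    · exact ⟨some ∘ u, by rwa [glue_some], Set.range_comp _ _⟩
    · exact ⟨Fin.cons none (some ∘ u), by rwa [glue_none hμ], by
        rw [Fin.range_cons, Set.range_comp]⟩

/-- The cases depend on which of the two bases contain $e$. If neither or both do, this is basis
exchange for $\nu$ or $\mu$. If only the second one does, use `sdiff_singleton_mem_or`, whose first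
alternative brings in $e$ itself. If only the first one does, use `exists_insert_mem` to remove $e$
and `exists_exchange` to remove another element. -/
theorem exchangeProperty_glue (hμ : IsGrassmannPlucker μ) (hν : IsGrassmannPlucker ν)
    (h : PluckerFlagRel ν μ) :
    Matroid.ExchangeProperty fun B : Set (Option V) => B ∈ supportSets (glue μ ν) := by
  have hμ' := hμ.isAlternatingFun
  have hν' := hν.isAlternatingFun
  have hs := Option.some_injective V
  intro X Y hX hY a ha
  simp only [mem_supportSets_glue_iff hμ' hν'] at hX hY ⊢
  rcases hX with ⟨B, hB, rfl⟩ | ⟨D, hD, rfl⟩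
  · obtain ⟨⟨a, haB, rfl⟩, haY⟩ := ha
    rcases hY with ⟨B', hB', rfl⟩ | ⟨D', hD', rfl⟩
    · obtain ⟨b, hb, hb'⟩ := hν.exchange B B' hB hB' a ⟨haB, fun hh => haY ⟨a, hh, rfl⟩⟩
      refine ⟨some b, ?_, Or.inl ⟨_, hb', ?_⟩⟩
      · simpa using hb
      · rw [Set.image_insert_eq, Set.image_sdiff hs, Set.image_singleton]
    · rcases h.sdiff_singleton_mem_or hν' hμ' hB hD' (a := a)
        ⟨haB, fun hh => haY (Or.inr ⟨a, hh, rfl⟩)⟩ with h1 | ⟨b, hb, h1⟩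
      · refine ⟨none, by simp, Or.inr ⟨_, h1, ?_⟩⟩
        rw [Set.image_sdiff hs, Set.image_singleton]
      · refine ⟨some b, by simpa using hb, Or.inl ⟨_, h1, ?_⟩⟩
        rw [Set.image_insert_eq, Set.image_sdiff hs, Set.image_singleton]
  · have hset : ∀ a b : V, insert (some b) (insert none (some '' D) \ {some a})
        = insert none (some '' (insert b (D \ {a}))) := by
      intro a b
      ext (_ | e) <;> simp
    rcases hY with ⟨B', hB', rfl⟩ | ⟨D', hD', rfl⟩
    · rcases a with _ | a
      · obtain ⟨b, hb, h1⟩ := h.exists_insert_mem hν' hμ' hB' hD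
        refine ⟨some b, by simpa using hb, Or.inl ⟨_, h1, ?_⟩⟩
        ext (_ | e) <;> simp
      · obtain ⟨b, hb, h1, -⟩ := h.exists_exchange hν' hμ' hB' hD (a := a) (by simpa using ha)
        exact ⟨some b, by simpa using hb, Or.inr ⟨_, h1, hset a b⟩⟩
    · rcases a with _ | a
      · exact absurd (Set.mem_insert _ _) ha.2
      · obtain ⟨b, hb, h1⟩ := hμ.exchange D D' hD hD' a (by simpa using ha)
        exact ⟨some b, by simpa using hb, Or.inr ⟨_, h1, hset a b⟩⟩

/-- Exchange `a` out of the basis $\{y_k,a\}\cup A$ against the basis $y\setminus y_k$; the incoming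
element becomes the second argument. -/
theorem exists_cons_cons_ne_zero {m : ℕ} {φ : (Fin (m + 2) → V) → F} (h : IsAlternatingFun φ)
    (hφ : Matroid.ExchangeProperty fun B : Set V => B ∈ supportSets φ) {y : Fin (m + 3) → V}
    {k : Fin (m + 3)} {a : V} {A : Fin m → V} (h1 : φ (k.removeNth y) ≠ 0)
    (h2 : φ (Fin.cons (y k) (Fin.cons a A : Fin (m + 1) → V) : Fin (m + 2) → V) ≠ 0)
    (ha : a ∉ Set.range y) :
    ∃ b, φ (Fin.cons (y k) (Fin.cons (y b) A : Fin (m + 1) → V) : Fin (m + 2) → V) ≠ 0 := by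
  obtain ⟨_, ⟨⟨b, rfl⟩, hb⟩, z, hz, hzr⟩ := hφ _ _ ⟨_, h2, rfl⟩ ⟨_, h1, rfl⟩ a ⟨⟨1, by simp⟩, by
    rintro ⟨j, rfl⟩
    exact ha ⟨_, rfl⟩⟩
  have hinj := h.injective h2
  refine ⟨k.succAbove b, h.ne_zero_of_range_eq hz ?_ ?_⟩
  · rw [Fin.cons_injective_iff, Fin.cons_injective_iff, Fin.range_cons] at hinj ⊢
    simp only [Fin.range_cons, Set.mem_insert_iff, not_or] at hinj hb ⊢
    exact ⟨⟨fun hh => hb.1 hh.symm, hinj.1.2⟩, hb.2.2, hinj.2.2⟩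
  · rw [hzr]
    simp only [Fin.range_cons]
    rw [Fin.cons_injective_iff, Fin.cons_injective_iff, Fin.range_cons] at hinj
    ext e
    simp only [Set.mem_insert_iff, Set.mem_sdiff, Set.mem_singleton_iff, Fin.removeNth] at hinj ⊢
    constructor
    · rintro (rfl | rfl | he)
      · exact Or.inr ⟨Or.inl rfl, fun hh => hinj.1 (Or.inl hh)⟩
      · exact Or.inl rfl
      · exact Or.inr ⟨Or.inr (Or.inr he), fun hh => hinj.2.1 (hh ▸ he)⟩
    · rintro (rfl | ⟨rfl | rfl | he, hne⟩)
      · exact Or.inr (Or.inl rfl)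
      · exact Or.inl rfl
      · exact absurd rfl hne
      · exact Or.inr (Or.inr he)

end IsAlternatingFun

/-! ### Three-term relations of the glued function -/

namespace ThreeNull

variable {a b c : F}

theorem mul_left (s : F) (h : ThreeNull a b c) : ThreeNull (s * a) (s * b) (s * c) := by
  have := term_mul_mem_nullset s h
  rwa [mul_add, mul_add, ← term_mul, ← term_mul, ← term_mul, mul_left_comm s] at this

theorem of_eq_zero (ha : a = 0) (hb : b = 0) (hc : c = 0) : ThreeNull a b c := by
  simp [ThreeNull, ha, hb, hc, zero_mem_nullset]

theorem reverse (h : ThreeNull a b c) : ThreeNull c b a := by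
  rw [ThreeNull] at h ⊢
  convert h using 1
  abel

theorem swap_left (h : ThreeNull a b c) : ThreeNull b a (eps F * c) := by
  have := h.mul_left (eps F)
  rw [ThreeNull, eps_mul_eps_mul] at this
  rw [ThreeNull, add_comm (term b)]
  exact this

theorem swap_right (h : ThreeNull a b c) : ThreeNull (eps F * a) c b :=
  h.reverse.swap_left.reverse

theorem congr {a' b' c' : F} (h : ThreeNull a b c) (ha : a' = a) (hb : b' = b) (hc : c' = c) :
    ThreeNull a' b' c' := by
  rwa [ha, hb, hc]

theorem of_left_eq_zero (ha : a = 0) (h : b = c) : ThreeNull a b c := by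
  subst h
  rw [ThreeNull, ha, term_zero, zero_add, add_comm]
  exact term_add_eps_mul_mem b

theorem of_right_eq_zero (hc : c = 0) (h : a = b) : ThreeNull a b c :=
  (of_left_eq_zero hc h.symm).reverse

theorem of_middle_eq_zero (hb : b = 0) (h : c = eps F * a) : ThreeNull a b c := by
  rw [ThreeNull, hb, mul_zero, term_zero, add_zero, h]
  exact term_add_eps_mul_mem a

end ThreeNull

/-- The terms that move an entry of `A` vanish by `h0`, so only those for `a`, `b`, `c` remain.
Covers the relations of a single function and the flag relations alike. -/
theorem PluckerAt.threeNull {m q : ℕ} {ν : (Fin (m + 2) → V) → F} {μ : (Fin (q + 1) → V) → F}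
    {a b c : V} {A : Fin m → V} {x : Fin q → V}
    (h : PluckerAt ν μ (Fin.cons a (Fin.cons b (Fin.cons c A : Fin (m + 1) → V) :
      Fin (m + 2) → V) : Fin (m + 3) → V) x)
    (h0 : ∀ i, μ (Fin.cons (A i) x : Fin (q + 1) → V) = 0) :
    ThreeNull
      (ν (Fin.cons b (Fin.cons c A : Fin (m + 1) → V) : Fin (m + 2) → V)
        * μ (Fin.cons a x : Fin (q + 1) → V))
      (ν (Fin.cons a (Fin.cons c A : Fin (m + 1) → V) : Fin (m + 2) → V)
        * μ (Fin.cons b x : Fin (q + 1) → V))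
      (ν (Fin.cons a (Fin.cons b A : Fin (m + 1) → V) : Fin (m + 2) → V)
        * μ (Fin.cons c x : Fin (q + 1) → V)) := by
  rw [PluckerAt, SumNull, Fin.sum_univ_succ, Fin.sum_univ_succ, Fin.sum_univ_succ,
    Finset.sum_eq_zero, add_zero] at h
  · have e0 : (0 : Fin (m + 3)).removeNth (Fin.cons a (Fin.cons b (Fin.cons c A :
        Fin (m + 1) → V) : Fin (m + 2) → V) : Fin (m + 3) → V)
        = Fin.cons b (Fin.cons c A : Fin (m + 1) → V) := by
      funext i
      simp [Fin.removeNth]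
    have e1 : (Fin.succ 0 : Fin (m + 3)).removeNth (Fin.cons a (Fin.cons b (Fin.cons c A :
        Fin (m + 1) → V) : Fin (m + 2) → V) : Fin (m + 3) → V)
        = Fin.cons a (Fin.cons c A : Fin (m + 1) → V) := by
      rw [Fin.removeNth_succ_cons]
      congr 1
    have e2 : (Fin.succ (Fin.succ 0) : Fin (m + 3)).removeNth (Fin.cons a (Fin.cons b
        (Fin.cons c A : Fin (m + 1) → V) : Fin (m + 2) → V) : Fin (m + 3) → V)
        = Fin.cons a (Fin.cons b A : Fin (m + 1) → V) := by
      rw [Fin.removeNth_succ_cons, Fin.removeNth_succ_cons]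
      congr 2
    rw [e0, e1, e2] at h
    simp only [Fin.cons_zero, Fin.cons_succ, Fin.val_succ, Fin.val_zero, zero_add, pow_zero,
      pow_succ, one_mul, mul_assoc, eps_mul_eps_mul, ← add_assoc] at h
    exact h
  · intro i _
    simp only [Fin.cons_succ]
    rw [h0, mul_zero, term_zero]

namespace IsAlternatingFun

theorem cons_cons_self {m : ℕ} {φ : (Fin (m + 2) → V) → F} (h : IsAlternatingFun φ) (a : V)
    (A : Fin m → V) :
    φ (Fin.cons a (Fin.cons a A : Fin (m + 1) → V) : Fin (m + 2) → V) = 0 :=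
  h.cons_self ⟨0, rfl⟩

theorem cons_cons_comp_perm {m : ℕ} {φ : (Fin (m + 2) → V) → F} (h : IsAlternatingFun φ)
    (a b : V) (A : Fin m → V) (σ : Equiv.Perm (Fin m)) :
    φ (Fin.cons a (Fin.cons b (A ∘ σ) : Fin (m + 1) → V) : Fin (m + 2) → V)
      = permSign F σ * φ (Fin.cons a (Fin.cons b A : Fin (m + 1) → V) : Fin (m + 2) → V) := by
  have h1 : (Fin.cons b (A ∘ σ) : Fin (m + 1) → V)
      = (Fin.cons b A : Fin (m + 1) → V) ∘ Equiv.Perm.decomposeFin.symm (0, σ) := by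
    funext i
    refine Fin.cases ?_ (fun i => ?_) i
    · simp
    · simp [Equiv.Perm.decomposeFin_symm_apply_succ]
  rw [h1, h.cons_comp_perm, permSign, Equiv.Perm.decomposeFin.symm_sign]
  simp [permSign]

theorem cons_cons_cons {m : ℕ} {φ : (Fin (m + 1 + 2) → V) → F} (h : IsAlternatingFun φ)
    (a b c : V) (A : Fin m → V) :
    φ (Fin.cons a (Fin.cons b (Fin.cons c A : Fin (m + 1) → V) : Fin (m + 1 + 1) → V) :
      Fin (m + 1 + 2) → V)
      = φ (Fin.cons c (Fin.cons a (Fin.cons b A : Fin (m + 1) → V) : Fin (m + 1 + 1) → V) :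
      Fin (m + 1 + 2) → V) := by
  have e := h.cons_removeNth (Fin.cons a (Fin.cons b (Fin.cons c A : Fin (m + 1) → V) :
    Fin (m + 1 + 1) → V) : Fin (m + 1 + 2) → V) (Fin.succ (Fin.succ 0))
  rw [Fin.removeNth_succ_cons, Fin.removeNth_succ_cons] at e
  have e0 : (0 : Fin (m + 1)).removeNth (Fin.cons c A : Fin (m + 1) → V) = A := by
    funext i
    simp [Fin.removeNth]
  rw [e0] at e
  simp only [Fin.cons_zero, Fin.cons_succ, Fin.val_succ, Fin.val_zero, zero_add, pow_zero,
    pow_succ, one_mul, eps_mul_eps] at e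
  exact e.symm

variable {m : ℕ}

/-- The three-term relation for `φ` with common arguments `A`. -/
def ThreeTerm (φ : (Fin (m + 2) → V) → F) (A : Fin m → V) (a b c d : V) : Prop :=
  ThreeNull
    (φ (Fin.cons b (Fin.cons c A : Fin (m + 1) → V) : Fin (m + 2) → V)
      * φ (Fin.cons a (Fin.cons d A : Fin (m + 1) → V) : Fin (m + 2) → V))
    (φ (Fin.cons a (Fin.cons c A : Fin (m + 1) → V) : Fin (m + 2) → V)
      * φ (Fin.cons b (Fin.cons d A : Fin (m + 1) → V) : Fin (m + 2) → V))
    (φ (Fin.cons a (Fin.cons b A : Fin (m + 1) → V) : Fin (m + 2) → V)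
      * φ (Fin.cons c (Fin.cons d A : Fin (m + 1) → V) : Fin (m + 2) → V))

theorem threeTerm_comp_perm_iff {φ : (Fin (m + 2) → V) → F} (h : IsAlternatingFun φ)
    {A : Fin m → V} {a b c d : V} (σ : Equiv.Perm (Fin m)) :
    ThreeTerm φ (A ∘ σ) a b c d ↔ ThreeTerm φ A a b c d := by
  have key : ∀ s t : F, permSign F σ * s * (permSign F σ * t) = s * t := by
    intro s t
    rw [mul_mul_mul_comm, permSign_mul_self, one_mul]
  simp only [ThreeTerm, h.cons_cons_comp_perm, key]

theorem _root_.IsGrassmannPlucker.threeTerm {φ : (Fin (m + 2) → V) → F}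
    (h : IsGrassmannPlucker φ) (A : Fin m → V) (a b c d : V) : ThreeTerm φ A a b c d :=
  (pluckerFlagRel_succ_iff.1 h.plucker _ (Fin.cons d A)).threeNull fun i =>
    h.isAlternatingFun.cons_self ⟨i.succ, by simp⟩

theorem threeTerm_cons_iff {φ : (Fin (m + 1 + 2) → V) → F} (h : IsAlternatingFun φ)
    {A : Fin m → V} {a b c d e : V} :
    ThreeTerm φ (Fin.cons e A : Fin (m + 1) → V) a b c d ↔ ThreeNull
      (φ (Fin.cons e (Fin.cons b (Fin.cons c A : Fin (m + 1) → V) : Fin (m + 1 + 1) → V))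
        * φ (Fin.cons e (Fin.cons a (Fin.cons d A : Fin (m + 1) → V) : Fin (m + 1 + 1) → V)))
      (φ (Fin.cons e (Fin.cons a (Fin.cons c A : Fin (m + 1) → V) : Fin (m + 1 + 1) → V))
        * φ (Fin.cons e (Fin.cons b (Fin.cons d A : Fin (m + 1) → V) : Fin (m + 1 + 1) → V)))
      (φ (Fin.cons e (Fin.cons a (Fin.cons b A : Fin (m + 1) → V) : Fin (m + 1 + 1) → V))
        * φ (Fin.cons e (Fin.cons c (Fin.cons d A : Fin (m + 1) → V) : Fin (m + 1 + 1) → V))) := by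
  simp only [ThreeTerm, h.cons_cons_cons]

/-- Each product uses every one of `a`, `b`, `c`, `d` once, so one of its factors contains the new
element twice. -/
theorem threeTerm_of_none {φ : (Fin (m + 2) → Option V) → F} (h : IsAlternatingFun φ)
    {A : Fin m → Option V} (hA : none ∈ Set.range A) {a b c d : Option V}
    (h0 : a = none ∨ b = none ∨ c = none ∨ d = none) : ThreeTerm φ A a b c d := by
  have h1 : ∀ a, φ (Fin.cons none (Fin.cons a A : Fin (m + 1) → Option V) :
      Fin (m + 2) → Option V) = 0 :=
    fun a => h.cons_self (by rw [Fin.range_cons]; exact Or.inr hA)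
  have h2 : ∀ a, φ (Fin.cons a (Fin.cons none A : Fin (m + 1) → Option V) :
      Fin (m + 2) → Option V) = 0 := fun a => by rw [h.swap_cons_cons, h1, mul_zero]
  rcases h0 with rfl | rfl | rfl | rfl <;>
  exact ThreeNull.of_eq_zero (by simp [h1, h2]) (by simp [h1, h2]) (by simp [h1, h2])

/-- If none of the four arguments is $e$, this is a relation of $\nu$. If exactly one is $e$, it is
the flag relation `key` for the other three, up to order and sign. If $e$ occurs at least twice, the
product that pairs two copies is zero and the other two cancel. -/
theorem threeTerm_glue_some {μ : (Fin (m + 1) → V) → F} {ν : (Fin (m + 2) → V) → F}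
    (hμ : IsAlternatingFun μ) (hν : IsGrassmannPlucker ν) (h : PluckerFlagRel ν μ) (A : Fin m → V)
    (a b c d : Option V) : ThreeTerm (glue μ ν) (some ∘ A) a b c d := by
  have hφ := glue_isAlternatingFun hμ hν.isAlternatingFun
  have e1 : ∀ a b : V, glue μ ν (Fin.cons (some a) (Fin.cons (some b) (some ∘ A) :
      Fin (m + 1) → Option V) : Fin (m + 2) → Option V)
      = ν (Fin.cons a (Fin.cons b A : Fin (m + 1) → V)) := by
    intro a b
    rw [← Fin.comp_cons, ← Fin.comp_cons, glue_some]
  have e2 : ∀ b : V, glue μ ν (Fin.cons none (Fin.cons (some b) (some ∘ A) :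
      Fin (m + 1) → Option V) : Fin (m + 2) → Option V) = μ (Fin.cons b A) := by
    intro b
    rw [← Fin.comp_cons, glue_none hμ]
  have e3 : ∀ b : V, glue μ ν (Fin.cons (some b) (Fin.cons none (some ∘ A) :
      Fin (m + 1) → Option V) : Fin (m + 2) → Option V) = eps F * μ (Fin.cons b A) := by
    intro b
    rw [hφ.swap_cons_cons, e2]
  have e4 : glue μ ν (Fin.cons none (Fin.cons none (some ∘ A) : Fin (m + 1) → Option V) :
      Fin (m + 2) → Option V) = 0 := hφ.cons_self ⟨0, rfl⟩
  have key : ∀ a b c : V, ThreeNull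
      (ν (Fin.cons b (Fin.cons c A : Fin (m + 1) → V)) * μ (Fin.cons a A))
      (ν (Fin.cons a (Fin.cons c A : Fin (m + 1) → V)) * μ (Fin.cons b A))
      (ν (Fin.cons a (Fin.cons b A : Fin (m + 1) → V)) * μ (Fin.cons c A)) := fun a b c =>
    (pluckerFlagRel_succ_iff.1 h _ A).threeNull fun i => hμ.cons_self ⟨i, rfl⟩
  rcases a with _ | a <;> rcases b with _ | b
  · exact ThreeNull.of_right_eq_zero (by
      rw [hφ.cons_cons_self, zero_mul]) rfl
  · rcases c with _ | c
    · refine ThreeNull.of_middle_eq_zero (by rw [hφ.cons_cons_self, zero_mul]) ?_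
      rw [hφ.swap_cons_cons (some b) none, mul_assoc, eps_mul_eps_mul]
    · rcases d with _ | d
      · refine ThreeNull.of_left_eq_zero (by rw [e4, mul_zero]) ?_
        rw [e2, e2, e3, e3]
        ac_rfl
      · simp only [ThreeTerm, e1, e2]
        exact (key b c d).reverse.congr (by ac_rfl) (by ac_rfl) (by ac_rfl)
  · rcases c with _ | c
    · refine ThreeNull.of_left_eq_zero (by rw [e4, zero_mul]) rfl
    · rcases d with _ | d
      · refine ThreeNull.of_middle_eq_zero (by rw [e4, mul_zero]) ?_
        rw [e2, e3, e3]
        ac_rfl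
      · simp only [ThreeTerm, e1, e2, e3]
        exact (key a c d).swap_right.reverse.congr (by ac_rfl) (by ac_rfl) (by ac_rfl)
  · rcases c with _ | c
    · rcases d with _ | d
      · refine ThreeNull.of_right_eq_zero (by rw [e4, mul_zero]) ?_
        rw [e3, e3, mul_comm]
      · simp only [ThreeTerm, e1, e2, e3]
        exact ((key a b d).swap_left.mul_left (eps F)).congr (by ac_rfl) (by ac_rfl)
          (eps_mul_eps_mul _).symm
    · rcases d with _ | d
      · simp only [ThreeTerm, e1, e3]
        exact ((key a b c).mul_left (eps F)).congr (by ac_rfl) (by ac_rfl) (by ac_rfl)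
      · simp only [ThreeTerm, e1]
        exact hν.threeTerm A a b c d

theorem threeTerm_glue {μ : (Fin (m + 1) → V) → F} {ν : (Fin (m + 2) → V) → F}
    (hμ : IsGrassmannPlucker μ) (hν : IsGrassmannPlucker ν) (h : PluckerFlagRel ν μ)
    (A : Fin m → Option V) (a b c d : Option V) : ThreeTerm (glue μ ν) A a b c d := by
  have hφ := glue_isAlternatingFun hμ.isAlternatingFun hν.isAlternatingFun
  by_cases hA : ∀ i, A i ≠ none
  · obtain ⟨A, rfl⟩ := exists_eq_some_comp hA
    exact threeTerm_glue_some hμ.isAlternatingFun hν h A a b c d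
  push Not at hA
  obtain ⟨i, hi⟩ := hA
  by_cases h0 : a = none ∨ b = none ∨ c = none ∨ d = none
  · exact threeTerm_of_none hφ ⟨i, hi⟩ h0
  push Not at h0
  obtain ⟨ha, hb, hc, hd⟩ := h0
  obtain ⟨a, rfl⟩ := Option.ne_none_iff_exists'.1 ha
  obtain ⟨b, rfl⟩ := Option.ne_none_iff_exists'.1 hb
  obtain ⟨c, rfl⟩ := Option.ne_none_iff_exists'.1 hc
  obtain ⟨d, rfl⟩ := Option.ne_none_iff_exists'.1 hd
  obtain ⟨m, rfl⟩ : ∃ m', m = m' + 1 := ⟨m - 1, by have := i.isLt; omega⟩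
  -- With $e$ a common argument in front, every factor is a value of $\mu$, and the relation is a
  -- three-term relation of $\mu$. If $e$ is repeated in the common arguments, all factors vanish.
  rw [← threeTerm_comp_perm_iff hφ i.cycleRange.symm, Fin.comp_cycleRange_symm, hi]
  generalize i.removeNth A = A'
  refine (threeTerm_cons_iff hφ).2 ?_
  by_cases hA' : ∀ i, A' i ≠ none
  · obtain ⟨A', rfl⟩ := exists_eq_some_comp hA'
    have k : ∀ a b : V, glue μ ν (Fin.cons none (Fin.cons (some a) (Fin.cons (some b) (some ∘ A') :
        Fin (m + 1) → Option V) : Fin (m + 1 + 1) → Option V) : Fin (m + 1 + 2) → Option V)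
        = μ (Fin.cons a (Fin.cons b A' : Fin (m + 1) → V)) := by
      intro a b
      rw [← Fin.comp_cons, ← Fin.comp_cons]
      exact glue_none hμ.isAlternatingFun _
    exact (hμ.threeTerm A' a b c d).congr (congrArg₂ (· * ·) (k b c) (k a d))
      (congrArg₂ (· * ·) (k a c) (k b d)) (congrArg₂ (· * ·) (k a b) (k c d))
  · push Not at hA'
    obtain ⟨j, hj⟩ := hA'
    have e : ∀ a b, glue μ ν (Fin.cons none (Fin.cons a (Fin.cons b A' :
        Fin (m + 1) → Option V) : Fin (m + 1 + 1) → Option V) : Fin (m + 1 + 2) → Option V) = 0 :=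
      fun a b => hφ.cons_self ⟨j.succ.succ, by simp [hj]⟩
    exact ThreeNull.of_eq_zero (mul_eq_zero_of_left (e _ _) _) (mul_eq_zero_of_left (e _ _) _)
      (mul_eq_zero_of_left (e _ _) _)

/-- Over a perfect tract, glueing the two Grassmann-Plücker functions of a flag of rank `(r, r + 1)`
gives a Grassmann-Plücker function. -/
theorem glue_isGrassmannPlucker {τ : Involution F} (hF : IsPerfect τ) {r : ℕ}
    {μ : (Fin r → V) → F} {ν : (Fin (r + 1) → V) → F} (hμ : IsGrassmannPlucker μ)
    (hν : IsGrassmannPlucker ν) (h : PluckerFlagRel ν μ) : IsGrassmannPlucker (glue μ ν) := by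
  have hφ := glue_isAlternatingFun hμ.isAlternatingFun hν.isAlternatingFun
  refine ⟨?_, hφ.map_swap, hφ.map_eq_zero, ?_⟩
  · obtain ⟨u, hu⟩ := hν.exists_ne_zero
    exact ⟨some ∘ u, by rwa [glue_some]⟩
  · rw [pluckerFlagRel_succ_iff]
    intro y x
    -- For $r=0$ the glued function has rank $1$: three-term relations need rank at least $2$, but
    -- the tuple `x` is empty and the relation is trivial.
    rcases r with _ | m
    · refine hφ.pluckerAt_of_range_subset ?_
      rintro _ ⟨i, _⟩
      exact i.elim0
    · exact pluckerAt_of_threeNull hF hφ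
        (fun y k a A h1 h2 h3 =>
          hφ.exists_cons_cons_ne_zero (exchangeProperty_glue hμ hν h) h1 h2 h3)
        (threeTerm_glue hμ hν h) y x

end IsAlternatingFun

end

/-! ### Contraction and deletion of the new element -/

theorem IsGrassmannPlucker.const_mul {F : Type u} [Tract F] {V : Type v} {r : ℕ}
    {φ : (Fin r → V) → F} (h : IsGrassmannPlucker φ) (c : Fˣ) :
    IsGrassmannPlucker fun x => (c : F) * φ x where
  exists_ne_zero := by
    obtain ⟨x, hx⟩ := h.exists_ne_zero
    exact ⟨x, mul_ne_zero c.ne_zero hx⟩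
  map_swap x i j hij := by rw [h.map_swap x i j hij, mul_left_comm]
  map_eq_zero x i j hij hx := by rw [h.map_eq_zero x i j hij hx, mul_zero]
  plucker q hq x y := by
    have := (h.plucker q hq x y).mul_left ((c : F) * c)
    convert this using 2 with k
    beta_reduce
    ac_rfl

namespace GPFun

variable {F : Type u} [Tract F] {E : Type v}

theorem _root_.FMatroid.mk_eq_mk_iff {φ ψ : GPFun F E} :
    FMatroid.mk φ = FMatroid.mk ψ ↔ Equivalent φ ψ := Quotient.eq

theorem equivalent_mk_iff {r : ℕ} {f g : (Fin r → E) → F} {hf : IsGrassmannPlucker f}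
    {hg : IsGrassmannPlucker g} :
    Equivalent ⟨r, f, hf⟩ ⟨r, g, hg⟩ ↔ ∃ a : Fˣ, ∀ x, f x = a * g x :=
  ⟨fun ⟨_, h⟩ => h, fun h => ⟨rfl, h⟩⟩

/-- A basis meeting `A` inside a basis of the contraction by the complement of `A` contains that
basis. -/
theorem inter_eq_deletionSet (φ : GPFun F E) (A : Set E) {B : Set E} (hB : φ.matroid.IsBase B)
    (h : B ∩ A ⊆ deletionSet φ.matroid A) : B ∩ A = deletionSet φ.matroid A := by
  have hD : (φ.matroid.contract Aᶜ).IsBase (deletionSet φ.matroid A) :=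
    (φ.matroid.contract Aᶜ).exists_isBase.choose_spec
  refine (hD.eq_of_superset_spanning ?_ h).symm
  -- Since $B\subseteq(B\cap A)\cup A^c$, the set $B\cap A$ spans the contraction by $A^c$; a
  -- spanning subset of a basis is the whole basis.
  rw [Matroid.contract_spanning_iff (Set.subset_univ _)]
  refine ⟨hB.spanning.superset (fun e he => ?_) (Set.subset_univ _), ?_⟩
  · by_cases heA : e ∈ A
    · exact Or.inl ⟨he, heA⟩
    · exact Or.inr heA
  · exact (disjoint_compl_right (a := A)).mono_left Set.inter_subset_right

theorem deletionSet_subset (φ : GPFun F E) (A : Set E) : deletionSet φ.matroid A ⊆ A := by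
  have hD : (φ.matroid.contract Aᶜ).IsBase (deletionSet φ.matroid A) :=
    (φ.matroid.contract Aᶜ).exists_isBase.choose_spec
  have := hD.subset_ground
  rw [Matroid.contract_ground, φ.matroid_ground, ← Set.compl_eq_univ_sdiff, compl_compl] at this
  exact this

theorem contractionSet_subset (N : Matroid E) (A : Set E) : contractionSet N A ⊆ A :=
  (N.exists_isBasis' A).choose_spec.subset

theorem mem_contractionSet {N : Matroid E} {A : Set E} {a : E} (ha : a ∈ A)
    (h : N.Indep (insert a (contractionSet N A))) : a ∈ contractionSet N A :=
  (N.exists_isBasis' A).choose_spec.mem_of_insert_indep ha h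

variable [Finite E] {r : ℕ} {f : (Fin (r + 1) → Option E) → F} {hf : IsGrassmannPlucker f}

/-- Contraction puts the fixed element last, whereas `glue` has it first. Moving it costs
$\epsilon^r$, which is absorbed into the unit. -/
theorem fix_singleton_none_equivalent_iff {I : Set (Option E)} (hI : I = {none}) (h)
    {μ : (Fin r → E) → F} {hμ : IsGrassmannPlucker μ} :
    Equivalent ((GPFun.fix ⟨r + 1, f, hf⟩ {none}ᶜ I h).relabel (removeNoneEquiv E)) ⟨r, μ, hμ⟩ ↔
      ∃ a : Fˣ, ∀ x : Fin r → E, f (Fin.cons none (some ∘ x) : Fin (r + 1) → Option E)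
        = a * μ x := by
  subst hI
  have hc : ({none} : Set (Option E)).ncard = 1 := Set.ncard_singleton _
  have hr : r + 1 - ({none} : Set (Option E)).ncard = r := by rw [hc]; rfl
  have key : ∀ x : Fin (r + 1 - ({none} : Set (Option E)).ncard) → E,
      ((GPFun.fix ⟨r + 1, f, hf⟩ {none}ᶜ {none} h).relabel (removeNoneEquiv E)).toFun x
        = eps F ^ r * f (Fin.cons none (some ∘ (x ∘ Fin.cast hr.symm)) :
          Fin (r + 1) → Option E) := by
    intro x
    have hle : r + 1 = r + 1 - ({none} : Set (Option E)).ncard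
        + ({none} : Set (Option E)).ncard := by omega
    change f (Fin.append (Subtype.val ∘ ((removeNoneEquiv E).symm ∘ x)) (enum {none})
      ∘ Fin.cast hle) = _
    set z := Fin.append (Subtype.val ∘ ((removeNoneEquiv E).symm ∘ x)) (enum {none})
      ∘ Fin.cast hle with hz
    have hlast : z (Fin.last r) = none := by
      have e : Fin.cast hle (Fin.last r) = Fin.natAdd _ (Fin.cast hc.symm 0) := by
        ext
        simp only [Fin.val_cast, Fin.val_last, Fin.val_natAdd, Fin.val_zero, hc]
        omega
      have hm : enum ({none} : Set (Option E)) (Fin.cast hc.symm 0) ∈ ({none} : Set (Option E)) :=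
        (range_enum ({none} : Set (Option E))).subset (Set.mem_range_self _)
      rw [hz, Function.comp_apply, e, Fin.append_right]
      exact hm
    have hrem : (Fin.last r).removeNth z = some ∘ (x ∘ Fin.cast hr.symm) := by
      funext i
      have e : Fin.cast hle ((Fin.last r).succAbove i) = Fin.castAdd _ (Fin.cast hr.symm i) := by
        ext
        simp
      rw [Fin.removeNth, hz, Function.comp_apply, e, Fin.append_left]
      rfl
    have := hf.isAlternatingFun.cons_removeNth z (Fin.last r)
    rw [hlast, hrem, Fin.val_last] at this
    rw [this, ← mul_assoc, ← mul_pow, eps_mul_eps, one_pow, one_mul]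
  have hsq : eps F ^ r * eps F ^ r = 1 := by rw [← mul_pow, eps_mul_eps, one_pow]
  constructor
  · rintro ⟨hr', a, ha⟩
    refine ⟨epsUnit F ^ r * a, fun x => ?_⟩
    have h1 := ha (x ∘ Fin.cast hr)
    have h1 := (key _).symm.trans h1
    calc _ = eps F ^ r * (eps F ^ r * f (Fin.cons none (some ∘ x) : Fin (r + 1) → Option E)) := by
          rw [← mul_assoc, hsq, one_mul]
      _ = eps F ^ r * (a * μ x) := congrArg _ h1
      _ = _ := by rw [Units.val_mul, Units.val_pow_eq_pow_val, mul_assoc]; rfl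
  · rintro ⟨a, ha⟩
    refine ⟨hr, epsUnit F ^ r * a, fun x => (key x).trans ?_⟩
    rw [ha, Units.val_mul, Units.val_pow_eq_pow_val, mul_assoc]
    rfl

theorem fix_empty_equivalent_iff {I : Set (Option E)} (hI : I = ∅) (h)
    {ν : (Fin (r + 1) → E) → F} {hν : IsGrassmannPlucker ν} :
    Equivalent ((GPFun.fix ⟨r + 1, f, hf⟩ {none}ᶜ I h).relabel (removeNoneEquiv E))
      ⟨r + 1, ν, hν⟩ ↔ ∃ a : Fˣ, ∀ x : Fin (r + 1) → E, f (some ∘ x) = a * ν x := by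
  subst hI
  have hr : r + 1 - (∅ : Set (Option E)).ncard = r + 1 := by rw [Set.ncard_empty]; rfl
  have key : ∀ x : Fin (r + 1 - (∅ : Set (Option E)).ncard) → E,
      ((GPFun.fix ⟨r + 1, f, hf⟩ {none}ᶜ ∅ h).relabel (removeNoneEquiv E)).toFun x
        = f (some ∘ (x ∘ Fin.cast hr.symm)) := by
    intro x
    change f (Fin.append (Subtype.val ∘ ((removeNoneEquiv E).symm ∘ x)) (enum ∅)
      ∘ Fin.cast _) = _
    congr 1
    funext i
    have e : ∀ hle : r + 1 = r + 1 - (∅ : Set (Option E)).ncard + (∅ : Set (Option E)).ncard,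
        Fin.cast hle i = Fin.castAdd _ (Fin.cast hr.symm i) := by
      intro hle
      ext
      simp
    rw [Function.comp_apply, e, Fin.append_left]
    rfl
  constructor
  · rintro ⟨hr', a, ha⟩
    refine ⟨a, fun x => ?_⟩
    have h1 := ha (x ∘ Fin.cast hr)
    exact (key _).symm.trans h1
  · rintro ⟨a, ha⟩
    exact ⟨hr, a, fun x => (key x).trans (ha _)⟩

/-- The elementary quotient `(M / e, M \ e)` in terms of Grassmann-Plücker functions. -/
theorem contractDelete_mk_eq_iff {μ : (Fin r → E) → F} {ν : (Fin (r + 1) → E) → F}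
    {hμ : IsGrassmannPlucker μ} {hν : IsGrassmannPlucker ν} :
    (FMatroid.mk ⟨r + 1, f, hf⟩).contractDelete
        = ![FMatroid.mk ⟨r, μ, hμ⟩, FMatroid.mk ⟨r + 1, ν, hν⟩] ↔
      (∃ a : Fˣ, ∀ x : Fin r → E, f (Fin.cons none (some ∘ x) : Fin (r + 1) → Option E)
        = a * μ x) ∧ ∃ b : Fˣ, ∀ x : Fin (r + 1) → E, f (some ∘ x) = b * ν x := by
  set φ : GPFun F (Option E) := ⟨r + 1, f, hf⟩
  have h1 : (FMatroid.mk φ).contractDelete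
        = ![FMatroid.mk ⟨r, μ, hμ⟩, FMatroid.mk ⟨r + 1, ν, hν⟩] ↔
      Equivalent ((φ.contract {none}).relabel (removeNoneEquiv E)) ⟨r, μ, hμ⟩ ∧
      Equivalent ((φ.delete {none}).relabel (removeNoneEquiv E)) ⟨r + 1, ν, hν⟩ := by
    rw [← FMatroid.mk_eq_mk_iff, ← FMatroid.mk_eq_mk_iff]
    constructor
    · intro h
      exact ⟨congrFun h 0, congrFun h 1⟩
    · rintro ⟨h, h'⟩
      funext i
      fin_cases i
      exacts [h, h']
  rw [h1]
  constructor
  · intro h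
    -- The fixed sets are subsets of $\{e\}$, so the ranks determine them: contraction fixes $e$ and
    -- deletion fixes nothing.
    have hc1 : r + 1 - (contractionSet φ.matroid {none}).ncard = r := h.1.1
    have hd1 : r + 1 - (deletionSet φ.matroid {none}).ncard = r + 1 := h.2.1
    have hc : contractionSet φ.matroid {none} = {none} := by
      refine (Set.subset_singleton_iff_eq.1 (contractionSet_subset _ _)).resolve_left fun h0 => ?_
      rw [h0, Set.ncard_empty] at hc1
      omega
    have hd : deletionSet φ.matroid {none} = ∅ := by
      refine (Set.subset_singleton_iff_eq.1 (deletionSet_subset _ _)).resolve_right fun h0 => ?_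
      rw [h0, Set.ncard_singleton] at hd1
      omega
    exact ⟨(fix_singleton_none_equivalent_iff hc _).1 h.1, (fix_empty_equivalent_iff hd _).1 h.2⟩
  · rintro ⟨⟨a, ha⟩, b, hb⟩
    -- Conversely, nonzero values of $\mu$ and $\nu$ give a basis containing $e$ and a basis
    -- avoiding $e$, so $e$ is neither a loop nor a coloop.
    have hc : contractionSet φ.matroid {none} = {none} := by
      refine (contractionSet_subset _ _).antisymm (Set.singleton_subset_iff.2
        (mem_contractionSet rfl ?_))
      obtain ⟨x, hx⟩ := hμ.exists_ne_zero
      have hB : φ.matroid.IsBase (Set.range (Fin.cons none (some ∘ x) : Fin (r + 1) → Option E)) :=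
        ⟨_, (ha x).trans_ne (mul_ne_zero a.ne_zero hx), rfl⟩
      refine hB.indep.subset (Set.insert_subset ⟨0, rfl⟩
        ((contractionSet_subset _ _).trans ?_))
      rintro _ rfl
      exact ⟨0, rfl⟩
    have hd : deletionSet φ.matroid {none} = ∅ := by
      obtain ⟨x, hx⟩ := hν.exists_ne_zero
      have hB : φ.matroid.IsBase (Set.range (some ∘ x)) :=
        ⟨_, (hb x).trans_ne (mul_ne_zero b.ne_zero hx), rfl⟩
      have h0 : Set.range (some ∘ x) ∩ {none} = ∅ := by
        ext e
        simp only [Set.mem_inter_iff, Set.mem_range, Function.comp_apply, Set.mem_singleton_iff,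
          Set.mem_empty_iff_false, iff_false, not_and]
        rintro ⟨i, rfl⟩
        exact Option.some_ne_none _
      rw [← inter_eq_deletionSet φ {none} hB (by rw [h0]; exact Set.empty_subset _), h0]
    exact ⟨(fix_singleton_none_equivalent_iff hc _).2 ⟨a, ha⟩,
      (fix_empty_equivalent_iff hd _).2 ⟨b, hb⟩⟩

/-- The ranks of `M / e` and `M \ e` differ only if the rank of `M` is the rank of `M \ e`. -/
theorem rank_eq_of_contractDelete {φ : GPFun F (Option E)} {μ : (Fin r → E) → F}
    {ν : (Fin (r + 1) → E) → F} {hμ : IsGrassmannPlucker μ} {hν : IsGrassmannPlucker ν}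
    (h : (FMatroid.mk φ).contractDelete
      = ![FMatroid.mk ⟨r, μ, hμ⟩, FMatroid.mk ⟨r + 1, ν, hν⟩]) : φ.rank = r + 1 := by
  have h0 : φ.rank - (contractionSet φ.matroid {none}).ncard = r :=
    (FMatroid.mk_eq_mk_iff.1 (congrFun h 0)).1
  have h1 : φ.rank - (deletionSet φ.matroid {none}).ncard = r + 1 :=
    (FMatroid.mk_eq_mk_iff.1 (congrFun h 1)).1
  have hc := Set.ncard_le_ncard (contractionSet_subset φ.matroid {none})
  rw [Set.ncard_singleton] at hc
  omega

end GPFun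

/-! ### Existence and classification of lifts -/

namespace FMatroid

open IsAlternatingFun

variable {F : Type u} [Tract F] {E : Type v} [Finite E]

theorem exists_contractDelete_eq_and_nonempty_equiv {τ : Involution F} (hF : IsPerfect τ) {r : ℕ}
    {M : Fin 2 → FMatroid F E} (hM : IsFlag M) (hr : flagRank M = ![r, r + 1]) :
    (∃ Mhat : FMatroid F (Option E), Mhat.rank = r + 1 ∧ Mhat.contractDelete = M) ∧
      Nonempty ({Mhat : FMatroid F (Option E) // Mhat.contractDelete = M} ≃ Fˣ) := by
  obtain ⟨⟨r0, μ, hμ⟩, h0⟩ := Quotient.exists_rep (M 0)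
  obtain ⟨⟨r1, ν, hν⟩, h1⟩ := Quotient.exists_rep (M 1)
  obtain rfl : r0 = r := by
    have := congrFun hr 0
    rwa [flagRank, ← h0] at this
  obtain rfl : r1 = r0 + 1 := by
    have := congrFun hr 1
    rwa [flagRank, ← h1] at this
  have hM' : M = ![mk ⟨r0, μ, hμ⟩, mk ⟨r0 + 1, ν, hν⟩] := by
    funext i
    fin_cases i
    exacts [h0.symm, h1.symm]
  -- The quotient condition covers all representatives, so it also covers the rescaled ones needed
  -- for the family of lifts.
  have hflag : ∀ c : Fˣ, PluckerFlagRel ν fun x => (c : F) * μ x := fun c =>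
    hM 0 1 (by simp) ⟨r0, _, hμ.const_mul c⟩ ⟨r0 + 1, ν, hν⟩
      ((mk_eq_mk_iff.2 (GPFun.equivalent_mk_iff.2 ⟨c, fun _ => rfl⟩)).trans h0) h1
  let hat : Fˣ → GPFun F (Option E) := fun c =>
    ⟨r0 + 1, glue (fun x => (c : F) * μ x) ν,
      glue_isGrassmannPlucker hF (hμ.const_mul c) hν (hflag c)⟩
  have hnone : ∀ (c : Fˣ) (x : Fin r0 → E), glue (fun x => (c : F) * μ x) ν
      (Fin.cons none (some ∘ x) : Fin (r0 + 1) → Option E) = c * μ x := fun c x =>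
    glue_none (hμ.const_mul c).isAlternatingFun x
  have hhat : ∀ c, (mk (hat c)).contractDelete = M := by
    intro c
    rw [hM', GPFun.contractDelete_mk_eq_iff]
    exact ⟨⟨c, hnone c⟩, 1, fun x => by rw [glue_some, Units.val_one, one_mul]⟩
  refine ⟨⟨mk (hat 1), rfl, hhat 1⟩, ⟨(Equiv.ofBijective
    (fun c : Fˣ => (⟨mk (hat c), hhat c⟩ : {Mhat : FMatroid F (Option E) //
      Mhat.contractDelete = M})) ⟨fun c d hcd => ?_, ?_⟩).symm⟩⟩
  -- Injectivity: on tuples without $e$ both functions equal $\nu$, so the scaling factor is $1$; a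
  -- nonzero value of $\mu$ then gives $c=d$.
  · obtain ⟨a, ha⟩ := GPFun.equivalent_mk_iff.1 (mk_eq_mk_iff.1 (congrArg Subtype.val hcd))
    obtain ⟨y, hy⟩ := hν.exists_ne_zero
    obtain ⟨x, hx⟩ := hμ.exists_ne_zero
    have e1 := ha (some ∘ y)
    have e2 := ha (Fin.cons none (some ∘ x))
    rw [glue_some, glue_some] at e1
    rw [hnone, hnone, (mul_eq_right₀ hy).1 e1.symm, one_mul] at e2
    exact Units.ext (mul_right_cancel₀ hx e2)
  · rintro ⟨N, hN⟩
    obtain ⟨φ, rfl⟩ := Quotient.exists_rep N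
    have hφ : (mk φ).contractDelete = _ := hN.trans hM'
    have hrank := GPFun.rank_eq_of_contractDelete hφ
    obtain ⟨r', f, hf⟩ := φ
    dsimp only at hrank
    subst hrank
    obtain ⟨⟨a, ha⟩, b, hb⟩ := GPFun.contractDelete_mk_eq_iff.1 hφ
    -- Dividing `f` by $b$ makes its restriction to $E$ equal to $\nu$, and its values at $(e,x)$
    -- become $b^{-1}a\,\mu(x)$.
    refine ⟨b⁻¹ * a, Subtype.ext (mk_eq_mk_iff.2 (GPFun.equivalent_mk_iff.2 ⟨b⁻¹, ?_⟩))⟩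
    refine congrFun (ext_option (hat (b⁻¹ * a)).isGP.isAlternatingFun
      (hf.const_mul b⁻¹).isAlternatingFun (fun x => ?_) fun x => ?_)
    · refine (glue_some x).trans ?_
      rw [hb, Units.inv_mul_cancel_left]
    · refine (hnone _ x).trans ?_
      rw [ha, Units.val_mul, mul_assoc]

end FMatroid

/-! ### Flags of minors -/

/-- The Plücker relation of `φ` for $(y,a)$ and $(x,b)$ is the flag relation plus the terms that
move some $a_t$. The alternatives in `hab` are three reasons for such a term to vanish: $a_t$ is
repeated in $b$; the factor containing $a_t$ and $b$ is zero; or the factor from which $a_t$ is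
omitted is zero. -/
theorem IsGrassmannPlucker.pluckerFlagRel_append {F : Type u} [Tract F] {E : Type v} {V : Type w}
    {r k l m n : ℕ} {φ : (Fin r → V) → F} (h : IsGrassmannPlucker φ) (hr : r = l + m)
    (hr' : r = k + n) (f : E → V) (a : Fin m → V) (b : Fin n → V)
    (hab : ∀ t, a t ∈ Set.range b ∨
      (∀ u, insert (a t) (Set.range b) ⊆ Set.range u →
        Set.range u ⊆ Set.range f ∪ insert (a t) (Set.range b) → φ u = 0) ∨
      ∀ u, Set.range u ⊆ Set.range f ∪ a '' {t}ᶜ → φ u = 0) :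
    PluckerFlagRel (fun y : Fin l → E => φ (Fin.append (f ∘ y) a ∘ Fin.cast hr))
      (fun x : Fin k → E => φ (Fin.append (f ∘ x) b ∘ Fin.cast hr')) := by
  subst hr
  rintro q rfl x y
  have hidx : (l + 1) + m = (l + m) + 1 := by omega
  have key := h.plucker (q + n) (by omega) (Fin.append (f ∘ x) b)
    (Fin.append (f ∘ y) a ∘ Fin.cast hidx.symm)
  unfold Tract.SumNull at key ⊢
  rw [← (finCongr hidx).sum_comp, Fin.sum_univ_add] at key
  beta_reduce at key ⊢
  have hcons : ∀ c : V, (Fin.cons c (Fin.append (f ∘ x) b) : Fin (q + n + 1) → V)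
      ∘ Fin.cast (by omega : l + m = q + n + 1)
      = Fin.append (Fin.cons c (f ∘ x) : Fin (q + 1) → V) b ∘ Fin.cast hr' := by
    intro c
    rw [Fin.append_cons]
    rfl
  rw [Finset.sum_eq_zero (s := Finset.univ (α := Fin m)), add_zero] at key
  · refine Eq.mp (congrArg (· ∈ _) (Finset.sum_congr rfl fun t _ => ?_)) key
    have h1 : (finCongr hidx (Fin.castAdd m t)).removeNth
        (Fin.append (f ∘ y) a ∘ Fin.cast hidx.symm) = Fin.append (f ∘ t.removeNth y) a := by
      funext i
      refine Fin.addCases (fun i => ?_) (fun i => ?_) i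
      · have : Fin.cast hidx.symm ((finCongr hidx (Fin.castAdd m t)).succAbove (Fin.castAdd m i))
            = Fin.castAdd m (t.succAbove i) := by
          ext
          simp only [Fin.succAbove, Fin.lt_def, finCongr_apply, Fin.val_cast, Fin.val_castAdd,
            Fin.val_castSucc]
          split_ifs <;> simp
        simp only [Fin.removeNth, Function.comp_apply, this, Fin.append_left]
      · have : Fin.cast hidx.symm
            ((finCongr hidx (Fin.castAdd m t)).succAbove (Fin.natAdd l i))
            = Fin.natAdd (l + 1) i := by
          ext
          have := t.isLt
          simp only [Fin.succAbove, Fin.lt_def, finCongr_apply, Fin.val_cast, Fin.val_castAdd,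
            Fin.val_castSucc, Fin.val_natAdd]
          split_ifs <;> simp <;> omega
        simp only [Fin.removeNth, Function.comp_apply, this, Fin.append_right]
    have h2 : (Fin.append (f ∘ y) a ∘ Fin.cast hidx.symm) (finCongr hidx (Fin.castAdd m t))
        = f (y t) := by simp
    have h3 : f ∘ (Fin.cons (y t) x : Fin (q + 1) → E)
        = (Fin.cons (f (y t)) (f ∘ x) : Fin (q + 1) → V) := Fin.comp_cons _ _ _
    rw [h1, hcons, h2]
    simp [h3]
  · intro t _
    have h2 : (Fin.append (f ∘ y) a ∘ Fin.cast hidx.symm) (finCongr hidx (Fin.natAdd (l + 1) t))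
        = a t := by simp
    rw [hcons, h2]
    have hrange : Set.range (Fin.append (Fin.cons (a t) (f ∘ x) : Fin (q + 1) → V) b
        ∘ Fin.cast hr') = insert (a t) (Set.range (f ∘ x)) ∪ Set.range b := by
      rw [← Fin.range_cons, ← GPFun.range_append]
      exact (finCongr hr').surjective.range_comp _
    rcases hab t with ht | ht | ht
    · rw [h.isAlternatingFun.eq_zero_of_not_injective (x := Fin.append _ b ∘ Fin.cast hr'),
        mul_zero, term_zero]
      intro hinj
      have hinj' := (Fin.append_injective_iff.1 ((hinj.comp (finCongr hr'.symm).injective :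
        Function.Injective (Fin.append (Fin.cons (a t) (f ∘ x) : Fin (q + 1) → V) b)))).2.2
      obtain ⟨s, hs⟩ := ht
      exact hinj' 0 s (by simpa using hs.symm)
    · rw [ht (Fin.append _ b ∘ Fin.cast hr'), mul_zero, term_zero]
      · rw [hrange]
        exact Set.insert_subset (Or.inl (Or.inl rfl)) Set.subset_union_right
      · rw [hrange]
        rintro e ((rfl | ⟨s, rfl⟩) | he)
        · exact Or.inr (Or.inl rfl)
        · exact Or.inl ⟨_, rfl⟩
        · exact Or.inr (Or.inr he)
    · rw [ht, mul_zero, zero_mul, term_zero]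
      rintro _ ⟨i, rfl⟩
      set T : Fin (l + m + 1) := finCongr hidx (Fin.natAdd (l + 1) t) with hT
      have hne := Fin.succAbove_ne T i
      obtain ⟨j, hj⟩ := (finCongr hidx).surjective (T.succAbove i)
      rw [← hj] at hne
      rw [Fin.removeNth, ← hj]
      clear hj
      revert hne
      refine Fin.addCases (fun j => ?_) (fun j => ?_) j
      · intro _
        exact Or.inl ⟨y j, by simp⟩
      · intro hne
        refine Or.inr ⟨j, fun hjt => hne ?_, by simp⟩
        rw [Set.mem_singleton_iff.1 hjt]

theorem Fin.append_comp_append_comp_cast {S : Type v} {V : Type w} {k m n r s : ℕ} (hs : s = k + m)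
    (hr : r = s + n) (hr' : r = k + (m + n)) (g : S → V) (x : Fin k → S) (a : Fin m → S)
    (b : Fin n → V) :
    Fin.append (g ∘ Fin.append x a ∘ Fin.cast hs) b ∘ Fin.cast hr
      = Fin.append (g ∘ x) (Fin.append (g ∘ a) b) ∘ Fin.cast hr' := by
  subst hs hr
  have h : g ∘ Fin.append x a = Fin.append (g ∘ x) (g ∘ a) := by
    funext i
    refine Fin.addCases (fun i => ?_) (fun i => ?_) i <;> simp
  simp only [Fin.cast_refl, Function.comp_id, h, Fin.append_assoc]

theorem PluckerFlagRel.of_equivalent {F : Type u} [Tract F] {E : Type v} {μ ν μ' ν' : GPFun F E}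
    (h : PluckerFlagRel ν.toFun μ.toFun) (hμ : GPFun.Equivalent μ' μ)
    (hν : GPFun.Equivalent ν' ν) : PluckerFlagRel ν'.toFun μ'.toFun := by
  obtain ⟨r, f, hf⟩ := μ
  obtain ⟨r', f', hf'⟩ := μ'
  obtain ⟨s, g, hg⟩ := ν
  obtain ⟨s', g', hg'⟩ := ν'
  obtain ⟨h1, c, hc⟩ := hμ
  obtain ⟨h2, d, hd⟩ := hν
  dsimp only at h1 h2 h
  subst h1 h2
  intro q hq x y
  have h3 := (h q hq x y).mul_left ((d : F) * c)
  convert h3 using 2 with k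
  rw [hc, hd]
  simp only [Fin.cast_refl, Function.comp_id]
  ac_rfl

namespace GPFun

variable {F : Type u} [Tract F] {E : Type v} {V : Type w} [Finite V]

/-- Transfers bases of `φ` to the deletion, so that maximality of the contracted independent set can
be used there. -/
theorem fix_isBase (φ : GPFun F V) {S I : Set V} (h) {B : Set V} (hB : φ.matroid.IsBase B)
    (hI : I ⊆ B) (hS : B \ I ⊆ S) : (φ.fix S I h).matroid.IsBase (Subtype.val ⁻¹' (B \ I)) := by
  have hle := φ.ncard_le h
  have hc : (B \ I).ncard = φ.rank - I.ncard := by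
    rw [Set.ncard_sdiff hI, φ.ncard_isBase hB]
  let x : Fin (φ.rank - I.ncard) → S := fun i =>
    ⟨enum (B \ I) (Fin.cast hc.symm i), hS ((range_enum (B \ I)).subset (Set.mem_range_self _))⟩
  have hx : Subtype.val ∘ x = enum (B \ I) ∘ Fin.cast hc.symm := rfl
  have hxr : Set.range (Subtype.val ∘ x) = B \ I := by
    rw [hx]
    exact ((finCongr hc.symm).surjective.range_comp (enum (B \ I))).trans (range_enum _)
  refine ⟨x, ?_, ?_⟩
  · obtain ⟨b, hb, rfl⟩ := hB
    refine φ.isGP.ne_zero_of_range_eq hb ?_ ?_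
    · refine Function.Injective.comp ?_ (finCongr hle).injective
      rw [Fin.append_injective_iff]
      refine ⟨?_, enum_injective I, ?_⟩
      · rw [hx]
        exact (enum_injective _).comp (finCongr hc.symm).injective
      · intro i j hij
        have h1 : (Subtype.val ∘ x) i ∈ Set.range b \ I := hxr.subset ⟨i, rfl⟩
        have h2 : enum I j ∈ I := (range_enum I).subset ⟨j, rfl⟩
        exact h1.2 (hij ▸ h2)
    · refine ((finCongr hle).surjective.range_comp
        (Fin.append (Subtype.val ∘ x) (enum I))).trans ?_
      rw [range_append, hxr, range_enum, Set.sdiff_union_of_subset hI]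
  · rw [← hxr, Set.range_comp, Set.preimage_image_eq _ Subtype.val_injective]
    rfl

/-- A minor is represented by fixing some arguments. -/
theorem exists_minor_eq (φ : GPFun F V) (I J : Set V)
    (e : ↥((Subtype.val ⁻¹' J : Set ↥Iᶜ)ᶜ) ≃ E) :
    ∃ (n : ℕ) (b : Fin n → V)
      (hr : φ.rank = (((φ.delete I).contract (Subtype.val ⁻¹' J)).relabel e).rank + n),
      Set.range b = Subtype.val '' contractionSet (φ.delete I).matroid (Subtype.val ⁻¹' J)
        ∪ deletionSet φ.matroid I ∧
      ∀ x, (((φ.delete I).contract (Subtype.val ⁻¹' J)).relabel e).toFun x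
        = φ.toFun (Fin.append ((fun s => (e.symm s).1.1) ∘ x) b ∘ Fin.cast hr) := by
  have h1 := φ.ncard_le (φ.deletionSet_spec I)
  have h2 := (φ.delete I).ncard_le ((φ.delete I).contractionSet_spec (Subtype.val ⁻¹' J))
  set C := contractionSet (φ.delete I).matroid (Subtype.val ⁻¹' J)
  set D := deletionSet φ.matroid I
  have hr : φ.rank = (((φ.delete I).contract (Subtype.val ⁻¹' J)).relabel e).rank
      + (C.ncard + D.ncard) := by
    rw [← add_assoc]
    change _ = (φ.delete I).rank - C.ncard + C.ncard + D.ncard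
    rw [← h2]
    exact h1
  refine ⟨C.ncard + D.ncard, Fin.append (Subtype.val ∘ enum C) (enum D), hr, ?_, fun x => ?_⟩
  · rw [range_append, Set.range_comp, range_enum, range_enum]
  · change φ.toFun (Fin.append (Subtype.val ∘ (Fin.append (Subtype.val ∘ (e.symm ∘ x)) (enum C)
      ∘ Fin.cast h2)) (enum D) ∘ Fin.cast h1) = _
    exact congrArg φ.toFun (Fin.append_comp_append_comp_cast h2 h1 hr _ _ _ _)

end GPFun

theorem FMatroid.isFlag_minor {F : Type u} [Tract F] {E : Type v} [Finite E] {p s : ℕ}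
    (M' : FMatroid F (E ⊕ Fin p)) {n : Fin s → ℕ} (hn : ∀ i j, i ≤ j → n j ≤ n i) :
    IsFlag fun i : Fin s =>
      (M'.minor (lastNew E p (n i)) (firstNew E p (n i))).relabel (removeNewEquiv E p (n i)) := by
  obtain ⟨φ, rfl⟩ := Quotient.exists_rep M'
  intro i j hij μ ν hμ hν
  have hji := hn i j hij.le
  beta_reduce at hμ hν
  generalize n i = c at hμ hji
  generalize n j = d at hν hji
  refine PluckerFlagRel.of_equivalent
    (μ := ((φ.delete (lastNew E p c)).contract
      (Subtype.val ⁻¹' firstNew E p c)).relabel (removeNewEquiv E p c))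
    (ν := ((φ.delete (lastNew E p d)).contract
      (Subtype.val ⁻¹' firstNew E p d)).relabel (removeNewEquiv E p d))
    ?_ (mk_eq_mk_iff.1 hμ) (mk_eq_mk_iff.1 hν)
  obtain ⟨k, b, hr', hb, hμ'⟩ := φ.exists_minor_eq (lastNew E p c) (firstNew E p c)
    (removeNewEquiv E p c)
  obtain ⟨m, a, hr, ha, hν'⟩ := φ.exists_minor_eq (lastNew E p d) (firstNew E p d)
    (removeNewEquiv E p d)
  have hainj : Function.Injective a := by
    obtain ⟨x, hx⟩ := (((φ.delete (lastNew E p d)).contract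
      (Subtype.val ⁻¹' firstNew E p d)).relabel (removeNewEquiv E p d)).isGP.exists_ne_zero
    rw [hν'] at hx
    have hinj := (φ.isGP.injective hx).comp (finCongr hr.symm).injective
    exact (Fin.append_injective_iff.1 hinj).2.1
  have hlast : ∀ (q : ℕ) (e : E), (Sum.inl e : E ⊕ Fin p) ∉ lastNew E p q := by
    rintro q e ⟨t, _, ht⟩
    exact Sum.inr_ne_inl ht
  have hfirst : ∀ q : ℕ, ∀ e ∈ firstNew E p q, e ∉ lastNew E p q := by
    rintro q _ ⟨t, ht, rfl⟩ ⟨t', ht', h⟩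
    replace ht' : q ≤ t.val := Sum.inr_injective h ▸ ht'
    exact absurd (lt_of_lt_of_le (show t.val < q from ht) ht') (lt_irrefl _)
  have hmono : firstNew E p d ⊆ firstNew E p c :=
    Set.image_mono fun t (ht : t.val < d) => lt_of_lt_of_le ht hji
  have key := φ.isGP.pluckerFlagRel_append hr hr' (Sum.inl : E → E ⊕ Fin p) a b fun t => ?_
  · rw [show (((φ.delete (lastNew E p d)).contract
      (Subtype.val ⁻¹' firstNew E p d)).relabel (removeNewEquiv E p d)).toFun = _ from funext hν',
      show (((φ.delete (lastNew E p c)).contract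
      (Subtype.val ⁻¹' firstNew E p c)).relabel (removeNewEquiv E p c)).toFun = _ from funext hμ']
    exact key
  · rcases ha.subset ⟨t, rfl⟩ with ⟨t', ht', ht⟩ | ht
    -- An element fixed by contraction in the larger-rank minor is also contracted in the other one.
    -- If it is not in `b`, a basis containing it and `b` would enlarge the maximal independent set
    -- that was contracted.
    · have hat : a t ∈ firstNew E p c := by
        rw [← ht]
        have ht1 : t' ∈ (Subtype.val ⁻¹' firstNew E p d : Set ↥(lastNew E p d)ᶜ) :=
          GPFun.contractionSet_subset _ _ ht'
        exact hmono ht1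
      by_cases hatb : a t ∈ Set.range b
      · exact Or.inl hatb
      refine Or.inr (Or.inl fun u hu hu' => ?_)
      by_contra hφ
      have hB : φ.matroid.IsBase (Set.range u) := ⟨u, hφ, rfl⟩
      have hDu : GPFun.deletionSet φ.matroid (lastNew E p c) ⊆ Set.range u :=
        (Set.subset_union_right.trans hb.symm.subset).trans ((Set.subset_insert _ _).trans hu)
      have hC := φ.fix_isBase (φ.deletionSet_spec (lastNew E p c)) hB hDu (by
        rintro e ⟨he, heD⟩
        rcases hu' he with ⟨e, rfl⟩ | rfl | he
        · exact hlast c e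
        · exact hfirst c _ hat
        · rcases hb.subset he with ⟨e', _, rfl⟩ | he
          · exact e'.2
          · exact absurd he heD)
      refine hatb (hb.symm.subset (Or.inl ⟨⟨a t, hfirst c _ hat⟩, ?_, rfl⟩))
      refine GPFun.mem_contractionSet hat (hC.indep.subset ?_)
      have hnot : ∀ e ∉ lastNew E p c, e ∉ GPFun.deletionSet φ.matroid (lastNew E p c) :=
        fun e he hh => he (φ.deletionSet_subset _ hh)
      refine Set.insert_subset ⟨hu (Or.inl rfl), hnot _ (hfirst c _ hat)⟩ fun e he => ?_
      exact ⟨hu (Or.inr (hb.symm.subset (Or.inl ⟨e, he, rfl⟩))), hnot _ e.2⟩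
    -- An element fixed by deletion: a basis inside $E\cup(a\setminus a_t)$ would meet the deleted
    -- set in a proper subset of the fixed basis, contradicting `inter_eq_deletionSet`.
    · refine Or.inr (Or.inr fun u hu => ?_)
      by_contra hφ
      have hB : φ.matroid.IsBase (Set.range u) := ⟨u, hφ, rfl⟩
      have h1 := φ.inter_eq_deletionSet (lastNew E p d) hB (by
        rintro e ⟨he, heI⟩
        rcases hu he with ⟨e, rfl⟩ | ⟨l, _, rfl⟩
        · exact absurd heI (hlast d e)
        · rcases ha.subset ⟨l, rfl⟩ with ⟨e', _, h'⟩ | h'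
          · exact absurd heI (h' ▸ e'.2)
          · exact h')
      rcases hu (h1.symm.subset ht).1 with ⟨e, he⟩ | ⟨l, hl, hlt⟩
      · exact hlast d e (he ▸ φ.deletionSet_subset _ ht)
      · exact hl (hainj hlt)

end

theorem theoremE {F : Type u} [Tract F] {E : Type v} [Finite E] :
    (∀ (p s : ℕ) (M' : FMatroid F (E ⊕ Fin p)) (n : Fin s → ℕ),
      (∀ i j, i ≤ j → n j ≤ n i) → (∀ i, n i ≤ p) →
      FMatroid.IsFlag fun i : Fin s =>
        (M'.minor (lastNew E p (n i)) (firstNew E p (n i))).relabel (removeNewEquiv E p (n i))) ∧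
    (∀ τ : Tract.Involution F, Tract.IsPerfect τ →
      ∀ (r : ℕ) (M : Fin 2 → FMatroid F E),
        FMatroid.IsFlag M → FMatroid.flagRank M = ![r, r + 1] →
        (∃ Mhat : FMatroid F (Option E), Mhat.rank = r + 1 ∧ Mhat.contractDelete = M) ∧
        Nonempty ({Mhat : FMatroid F (Option E) // Mhat.contractDelete = M} ≃ Fˣ)) :=
  ⟨fun _ _ M' _ hn _ => M'.isFlag_minor hn, fun _ hF _ _ hM hr =>
    FMatroid.exists_contractDelete_eq_and_nonempty_equiv hF hM hr⟩
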